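/- **Conventions.** A Lie groupoid $\mathcal G$ consists of smooth manifolds $\mathcal G_0$ of objects (Hausdorff, second countable) and $\mathcal G_1$ of arrows (not necessarily Hausdorff), each of some fixed finite dimension and without boundary, and smooth maps $\mathbf s,\mathbf t\colon\mathcal G_1\to\mathcal G_0$ (source and target, both submersions), $u\colon \mathcal G_0\to\mathcal G_1$ (units), $g\mapsto g^{-1}$ (inversion) and a multiplication $(g,h)\mapsto gh$, smooth on $\{(g,h):\mathbf s(g)=\mathbf t(h)\}$, satisfying the groupoid axioms. A homomorphism $F\colon\mathcal H\to\mathcal G$ is a pair of smooth maps $F_0\colon\mathcal H_0\to\mathcal G_0$, $F_1\colon\mathcal H_1\to\mathcal G_1$ compatible with source, target and multiplication. It is a *weak equivalence* if 1. the map $\{(g,x)\in\mathcal G_1\times\mathcal H_0:\mathbf s(g)=F_0(x)\}\to\mathcal G_0$, $(g,x)\mapsto\mathbf t(g)$, is a surjective submersion, and 2. the map $\mathcal H_1\to\{(x,g,y)\in\mathcal H_0\times\mathcal G_1\times\mathcal H_0: F_0(x)=\mathbf t(g),\ \mathbf s(g)=F_0(y)\}$, $h\mapsto(\mathbf t(h),F_1(h),\mathbf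 s(h))$, is a diffeomorphism. Two Lie groupoids are *Morita equivalent* if they are joined by a finite zig-zag of weak equivalences between Lie groupoids. For $n\ge1$ let $\mathcal G^{(n)}\subset\mathcal G_1^{\,n}$ be the manifold of strings $(g_n,\dots,g_1)$ with $\mathbf s(g_{i+1})=\mathbf t(g_i)$, and let $\mathcal G^{(0)}=\mathcal G_0$. The face maps $d^n_i\colon\mathcal G^{(n)}\to\mathcal G^{(n-1)}$, $0\le i\le n$, are $d^1_0=\mathbf t$, $d^1_1=\mathbf s$ and, for $n\ge2$, $d^n_0$ drops $g_1$, $d^n_n$ drops $g_n$, and $d^n_i$ replaces the pair $g_{i+1},g_i$ by $g_{i+1}g_i$ for $0<i<n$. The groupoid cochain complex $C(\mathcal G)$ is the complex of real vector spaces $C^\infty(\mathcal G^{(n)})$, $n\ge0$, with differential $$\delta^n=\sum_{i=0}^{n+1}(-1)^i(d^{n+1}_i)^*\colon C^\infty(\mathcal G^{(n)})\to C^\infty(\mathcal G^{(n+1)}),$$ and $H^n(C(\mathcal G))$ is its cohomology (the differentiable cohomology of $\mathcal G$). **Corollary.** If $\mathcal G$ and $\mathcal H$ are Morita equivalent Lie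 groupoids, then $H(C(\mathcal G))\cong H(C(\mathcal H))$: for every $n\ge0$ there is an isomorphism of real vector spaces $H^n(C(\mathcal G))\cong H^n(C(\mathcal H))$. -/

import Mathlib

open Set Function CategoryTheory
open scoped Manifold ContDiff

universe u

/-! ### Smooth maps on subsets of manifolds -/

section SmoothOnSubset

variable {E : Type*} [NormedAddCommGroup E] [NormedSpace ℝ E] {H : Type*} [TopologicalSpace H]
  {E' : Type*} [NormedAddCommGroup E'] [NormedSpace ℝ E'] {H' : Type*} [TopologicalSpace H']
  {E'' : Type*} [NormedAddCommGroup E''] [NormedSpace ℝ E''] {H'' : Type*} [TopologicalSpace H'']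
  {M : Type*} [TopologicalSpace M] [ChartedSpace H M]
  {N : Type*} [TopologicalSpace N] [ChartedSpace H' N]
  {P : Type*} [TopologicalSpace P] [ChartedSpace H'' P]

/-- A map `f : S → N` from a subset `S` of a manifold `M` to a manifold `N` is smooth if, near every
point of `S`, it is the restriction of a smooth map defined on an open subset of `M`. If `S` is an
embedded submanifold (such as a transverse fibre product inside a product), these are exactly the
smooth maps for the submanifold structure of `S`. -/
def SmoothOnSubset (I : ModelWithCorners ℝ E H) (J : ModelWithCorners ℝ E' H')
    (S : Set M) (f : S → N) : Prop :=
  ∀ x : S, ∃ U : Set M, IsOpen U ∧ (x : M) ∈ U ∧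
    ∃ f' : M → N, ContMDiffOn I J ∞ f' U ∧ ∀ y : S, (y : M) ∈ U → f' y = f y

variable {I : ModelWithCorners ℝ E H} {J : ModelWithCorners ℝ E' H'}
  {K : ModelWithCorners ℝ E'' H''} {S : Set M}

theorem SmoothOnSubset.of_contMDiff {f' : M → N} (hf : ContMDiff I J ∞ f') :
    SmoothOnSubset I J S (fun x => f' x) :=
  fun _ => ⟨univ, isOpen_univ, mem_univ _, f', hf.contMDiffOn, fun _ _ => rfl⟩

theorem SmoothOnSubset.comp {T : Set N} {h : T → P} {g : S → T}
    (hh : SmoothOnSubset J K T h) (hg : SmoothOnSubset I J S (fun x => (g x : N))) :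
    SmoothOnSubset I K S (fun x => h (g x)) := by
  intro x
  obtain ⟨U, hU, hxU, g', hg', hgU⟩ := hg x
  obtain ⟨V, hV, hxV, h', hh', hhV⟩ := hh (g x)
  refine ⟨U ∩ g' ⁻¹' V, hg'.continuousOn.isOpen_inter_preimage hU hV, ⟨hxU, ?_⟩, h' ∘ g', ?_, ?_⟩
  · rw [mem_preimage, hgU x hxU]
    exact hxV
  · exact hh'.comp (hg'.mono inter_subset_left) inter_subset_right
  · rintro y ⟨hyU, hyV⟩
    have e := hgU y hyU
    rw [mem_preimage, e] at hyV
    rw [comp_apply, e]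
    exact hhV _ hyV

theorem SmoothOnSubset.contMDiff_comp {h : N → P} {g : S → N}
    (hh : ContMDiff J K ∞ h) (hg : SmoothOnSubset I J S g) :
    SmoothOnSubset I K S (fun x => h (g x)) := by
  intro x
  obtain ⟨U, hU, hxU, g', hg', hgU⟩ := hg x
  exact ⟨U, hU, hxU, h ∘ g', hh.comp_contMDiffOn hg',
    fun y hy => by rw [comp_apply, hgU y hy]⟩

theorem SmoothOnSubset.prodMk {f : S → N} {g : S → P}
    (hf : SmoothOnSubset I J S f) (hg : SmoothOnSubset I K S g) :
    SmoothOnSubset I (J.prod K) S (fun x => (f x, g x)) := by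
  intro x
  obtain ⟨U, hU, hxU, f', hf', hfU⟩ := hf x
  obtain ⟨V, hV, hxV, g', hg', hgV⟩ := hg x
  refine ⟨U ∩ V, hU.inter hV, ⟨hxU, hxV⟩, fun y => (f' y, g' y),
    (hf'.mono inter_subset_left).prodMk (hg'.mono inter_subset_right), ?_⟩
  rintro y ⟨hyU, hyV⟩
  exact Prod.ext (hfU y hyU) (hgV y hyV)

section Pi

variable {ι : Type*} [Fintype ι]

theorem contMDiffOn_pi_manifold {f : M → ι → N} {U : Set M}
    (hf : ∀ i, ContMDiffOn I J ∞ (fun x => f x i) U) :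
    ContMDiffOn I (ModelWithCorners.pi fun _ : ι => J) ∞ f U := by
  intro x hx
  have h := fun i => contMDiffWithinAt_iff.1 (hf i x hx)
  exact contMDiffWithinAt_iff.2
    ⟨continuousWithinAt_pi.2 fun i => (h i).1, contDiffWithinAt_pi.2 fun i => (h i).2⟩

theorem contMDiff_eval_manifold (i : ι) :
    ContMDiff (ModelWithCorners.pi fun _ : ι => J) J ∞ (fun x : ι → N => x i) := by
  intro x
  refine contMDiffAt_iff.2 ⟨(continuous_apply i).continuousAt, ?_⟩
  refine (contDiff_apply ℝ E' i).contDiffWithinAt.congr_of_eventuallyEq_of_mem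
    ?_ (mem_range_self _)
  filter_upwards [extChartAt_target_mem_nhdsWithin
    (I := ModelWithCorners.pi fun _ : ι => J) x] with z hz
  exact congrFun ((extChartAt (ModelWithCorners.pi fun _ : ι => J) x).right_inv hz) i

theorem SmoothOnSubset.pi {f : S → ι → N} (hf : ∀ i, SmoothOnSubset I J S (fun x => f x i)) :
    SmoothOnSubset I (ModelWithCorners.pi fun _ : ι => J) S f := by
  intro x
  choose U hU hxU f' hf' hfU using fun i => hf i x
  refine ⟨⋂ i, U i, isOpen_iInter_of_finite hU, mem_iInter.2 hxU, fun y i => f' i y,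
    contMDiffOn_pi_manifold fun i => (hf' i).mono (iInter_subset U i), fun y hy => ?_⟩
  funext i
  exact hfU i y (mem_iInter.1 hy i)

end Pi

end SmoothOnSubset

/-! ### Lie groupoids -/

/-- A Lie groupoid `Arr ⇉ Obj`: a groupoid whose objects and arrows form smooth manifolds, whose
structure maps are smooth, and whose source and target are submersions. The manifold of objects is
Hausdorff and second countable; the manifold of arrows need not be. The arrow `mul ⟨(g, h), _⟩` is
the composite `g h`, defined when `src g = tgt h`. -/
structure LieGroupoid where
  /-- the objects -/
  Obj : Type u
  /-- the arrows -/
  Arr : Type u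
  /-- the dimension of the manifold of objects -/
  dimObj : ℕ
  /-- the dimension of the manifold of arrows -/
  dimArr : ℕ
  [topObj : TopologicalSpace Obj]
  [t2Obj : T2Space Obj]
  [sndObj : SecondCountableTopology Obj]
  [chartedObj : ChartedSpace (EuclideanSpace ℝ (Fin dimObj)) Obj]
  [manifoldObj : IsManifold (𝓡 dimObj) ∞ Obj]
  [topArr : TopologicalSpace Arr]
  [chartedArr : ChartedSpace (EuclideanSpace ℝ (Fin dimArr)) Arr]
  [manifoldArr : IsManifold (𝓡 dimArr) ∞ Arr]
  /-- the source map -/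
  src : Arr → Obj
  /-- the target map -/
  tgt : Arr → Obj
  /-- the identity arrows -/
  unit : Obj → Arr
  /-- the inversion -/
  inv : Arr → Arr
  /-- the multiplication of composable arrows -/
  mul : {p : Arr × Arr | src p.1 = tgt p.2} → Arr
  src_unit : ∀ x, src (unit x) = x
  tgt_unit : ∀ x, tgt (unit x) = x
  src_inv : ∀ g, src (inv g) = tgt g
  tgt_inv : ∀ g, tgt (inv g) = src g
  src_mul : ∀ p, src (mul p) = src p.1.2
  tgt_mul : ∀ p, tgt (mul p) = tgt p.1.1
  mul_assoc : ∀ (g h k : Arr) (hgh : src g = tgt h) (hhk : src h = tgt k),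
    mul ⟨(mul ⟨(g, h), hgh⟩, k), (src_mul ⟨(g, h), hgh⟩).trans hhk⟩ =
      mul ⟨(g, mul ⟨(h, k), hhk⟩), hgh.trans (tgt_mul ⟨(h, k), hhk⟩).symm⟩
  mul_unit : ∀ g, mul ⟨(g, unit (src g)), (tgt_unit _).symm⟩ = g
  unit_mul : ∀ g, mul ⟨(unit (tgt g), g), src_unit _⟩ = g
  mul_inv : ∀ g, mul ⟨(g, inv g), (tgt_inv g).symm⟩ = unit (tgt g)
  inv_mul : ∀ g, mul ⟨(inv g, g), src_inv g⟩ = unit (src g)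
  smooth_src : ContMDiff (𝓡 dimArr) (𝓡 dimObj) ∞ src
  smooth_tgt : ContMDiff (𝓡 dimArr) (𝓡 dimObj) ∞ tgt
  smooth_unit : ContMDiff (𝓡 dimObj) (𝓡 dimArr) ∞ unit
  smooth_inv : ContMDiff (𝓡 dimArr) (𝓡 dimArr) ∞ inv
  smooth_mul : SmoothOnSubset ((𝓡 dimArr).prod (𝓡 dimArr)) (𝓡 dimArr) _ mul
  submersion_src : ∀ g, Surjective (mfderiv (𝓡 dimArr) (𝓡 dimObj) src g)
  submersion_tgt : ∀ g, Surjective (mfderiv (𝓡 dimArr) (𝓡 dimObj) tgt g)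

namespace LieGroupoid

attribute [instance] topObj t2Obj sndObj chartedObj manifoldObj topArr chartedArr manifoldArr

/-! ### Weak equivalences and Morita equivalence -/

/-- A homomorphism of Lie groupoids `H → G`. -/
structure Hom (H G : LieGroupoid.{u}) where
  /-- the map on objects -/
  obj : H.Obj → G.Obj
  /-- the map on arrows -/
  arr : H.Arr → G.Arr
  smooth_obj : ContMDiff (𝓡 H.dimObj) (𝓡 G.dimObj) ∞ obj
  smooth_arr : ContMDiff (𝓡 H.dimArr) (𝓡 G.dimArr) ∞ arr
  src_arr : ∀ h, G.src (arr h) = obj (H.src h)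
  tgt_arr : ∀ h, G.tgt (arr h) = obj (H.tgt h)
  map_mul : ∀ p : {p : H.Arr × H.Arr | H.src p.1 = H.tgt p.2},
    arr (H.mul p) = G.mul ⟨(arr p.1.1, arr p.1.2),
      ((src_arr _).trans (congrArg obj p.2)).trans (tgt_arr _).symm⟩

/-- A smooth map `f : N → G.Obj` is smoothly essentially surjective if `(g, x) ↦ tgt g`, from the
fibre product `{(g, x) | src g = f x}` of `src` and `f` to `G.Obj`, is a surjective submersion. The
tangent space of the fibre product at `(g, x)` consists of the pairs of tangent vectors `(u, v)`
with `d(src)(u) = df(v)`. -/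
def SmoothlyEssentiallySurjective (G : LieGroupoid.{u}) {d : ℕ} {N : Type u} [TopologicalSpace N]
    [ChartedSpace (EuclideanSpace ℝ (Fin d)) N] (f : N → G.Obj) : Prop :=
  (∀ y : G.Obj, ∃ (g : G.Arr) (x : N), G.src g = f x ∧ G.tgt g = y) ∧
  ∀ (g : G.Arr) (x : N), G.src g = f x → ∀ w : TangentSpace (𝓡 G.dimObj) (G.tgt g),
    ∃ (u : TangentSpace (𝓡 G.dimArr) g) (v : TangentSpace (𝓡 d) x),
      tangentMap (𝓡 G.dimArr) (𝓡 G.dimObj) G.src ⟨g, u⟩ =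
        tangentMap (𝓡 d) (𝓡 G.dimObj) f ⟨x, v⟩ ∧
      mfderiv (𝓡 G.dimArr) (𝓡 G.dimObj) G.tgt g u = w

/-- The arrows `N ×_{f, tgt} G.Arr ×_{src, f} N` of the pullback groupoid of `G` along
`f : N → G.Obj`. -/
def pullbackArr (G : LieGroupoid.{u}) {N : Type u} (f : N → G.Obj) : Set (N × G.Arr × N) :=
  {p | f p.1 = G.tgt p.2.1 ∧ G.src p.2.1 = f p.2.2}

variable {G H : LieGroupoid.{u}}

/-- The natural map `h ↦ (tgt h, F h, src h)` from `H` to the pullback groupoid of `G` along the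
object map of `F : H → G`, on arrows. -/
def Hom.toPullback (F : Hom H G) (h : H.Arr) : G.pullbackArr F.obj :=
  ⟨(H.tgt h, F.arr h, H.src h), (F.tgt_arr h).symm, F.src_arr h⟩

/-- A homomorphism `F : H → G` is a weak equivalence if it is smoothly essentially surjective on
objects and the natural map from `H` to the pullback groupoid of `G` is an isomorphism of Lie
groupoids, that is, on arrows (where it is smooth) it is bijective with smooth inverse. -/
def Hom.IsWeakEquivalence (F : Hom H G) : Prop :=
  G.SmoothlyEssentiallySurjective (d := H.dimObj) F.obj ∧
  ∃ K : G.pullbackArr F.obj → H.Arr, LeftInverse K F.toPullback ∧ RightInverse K F.toPullback ∧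
    SmoothOnSubset ((𝓡 H.dimObj).prod ((𝓡 G.dimArr).prod (𝓡 H.dimObj))) (𝓡 H.dimArr)
      (G.pullbackArr F.obj) K

/-- Two Lie groupoids are Morita equivalent if they are joined by a finite zig-zag of weak
equivalences. -/
def MoritaEquivalent (G H : LieGroupoid.{u}) : Prop :=
  Relation.EqvGen (fun A B : LieGroupoid.{u} => ∃ F : Hom A B, F.IsWeakEquivalence) G H

/-! ### The nerve and the groupoid cochain complex -/

/-- The manifold in which the strings of `n` arrows and their `n + 1` objects live. -/
abbrev NerveAmbient (G : LieGroupoid.{u}) (n : ℕ) : Type u := (Fin (n + 1) → G.Obj) × (Fin n → G.Arr)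

/-- The product smooth structure of `G.NerveAmbient n`. -/
noncomputable abbrev nerveModel (G : LieGroupoid.{u}) (n : ℕ) :=
  (ModelWithCorners.pi fun _ : Fin (n + 1) => 𝓡 G.dimObj).prod
    (ModelWithCorners.pi fun _ : Fin n => 𝓡 G.dimArr)

/-- The space of strings of `n` composable arrows `x₀ → x₁ → ⋯ → xₙ`, where the `i`-th arrow goes
from `xᵢ` to `xᵢ₊₁`. For `n = 0` this is the space of objects; for `n ≥ 1` the objects are
determined by the arrows through `src` and `tgt`. -/
def nerve (G : LieGroupoid.{u}) (n : ℕ) : Set (G.NerveAmbient n) :=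
  {p | ∀ i : Fin n, G.src (p.2 i) = p.1 i.castSucc ∧ G.tgt (p.2 i) = p.1 i.succ}

theorem nerve_composable {n : ℕ} (p : G.nerve (n + 1)) (j : Fin n) :
    G.src (p.1.2 j.succ) = G.tgt (p.1.2 j.castSucc) :=
  (p.2 j.succ).1.trans (p.2 j.castSucc).2.symm

/-- The `j`-th arrow of the `i`-th face of a string of `n + 1` arrows. -/
def faceArr {n : ℕ} (i : Fin (n + 2)) (p : G.nerve (n + 1)) (j : Fin n) : G.Arr :=
  if (j : ℕ) + 1 < i then p.1.2 j.castSucc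
  else if (j : ℕ) + 1 = i then G.mul ⟨(p.1.2 j.succ, p.1.2 j.castSucc), nerve_composable p j⟩
  else p.1.2 j.succ

/-- The `i`-th face of a string of `n + 1` arrows: the object `xᵢ` is removed, and the two arrows
adjacent to it are composed (if `0 < i < n + 1`) or the one arrow adjacent to it is removed (if
`i = 0` or `i = n + 1`). -/
def face {n : ℕ} (i : Fin (n + 2)) (p : G.nerve (n + 1)) : G.nerve n :=
  ⟨(fun j => p.1.1 (i.succAbove j), faceArr i p), by
    intro j
    have h1 := p.2 j.castSucc
    have h2 := p.2 j.succ
    have e1 : (j : ℕ) + 1 ≤ i → i.succAbove j.castSucc = j.castSucc.castSucc := fun h =>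
      Fin.succAbove_of_castSucc_lt _ _ (by simp [Fin.lt_def]; omega)
    have e2 : ¬ (j : ℕ) + 1 ≤ i → i.succAbove j.castSucc = j.castSucc.succ := fun h =>
      Fin.succAbove_of_le_castSucc _ _ (by simp [Fin.le_def]; omega)
    have e3 : (j : ℕ) + 1 < i → i.succAbove j.succ = j.succ.castSucc := fun h =>
      Fin.succAbove_of_castSucc_lt _ _ (by simpa [Fin.lt_def] using h)
    have e4 : ¬ (j : ℕ) + 1 < i → i.succAbove j.succ = j.succ.succ := fun h =>
      Fin.succAbove_of_le_castSucc _ _ (by simpa [Fin.le_def] using h)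
    simp only [faceArr]
    split_ifs with ha hb
    · rw [e1 ha.le, e3 ha, ← Fin.succ_castSucc]
      exact h1
    · rw [e1 hb.le, e4 ha, G.src_mul, G.tgt_mul]
      exact ⟨h1.1, h2.2⟩
    · rw [e2 (by omega), e4 ha, Fin.succ_castSucc]
      exact h2⟩

theorem nerve_ext {n : ℕ} {p q : G.nerve n} (h1 : ∀ j, p.1.1 j = q.1.1 j)
    (h2 : ∀ j, p.1.2 j = q.1.2 j) : p = q :=
  Subtype.ext (Prod.ext (funext h1) (funext h2))

theorem face_face {n : ℕ} (i j : Fin (n + 2)) (hij : i ≤ j) (p : G.nerve (n + 2)) :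
    face i (face j.succ p) = face j (face i.castSucc p) := by
  have hij' : (i : ℕ) ≤ j := hij
  refine nerve_ext (fun k => ?_) (fun k => ?_)
  · refine congrArg p.1.1 (Fin.ext ?_)
    simp only [Fin.succAbove, Fin.lt_def, Fin.val_castSucc, Fin.val_succ]
    split_ifs <;> simp at * <;> omega
  · change faceArr i (face j.succ p) k = faceArr j (face i.castSucc p) k
    have hk : ∀ (q : G.nerve (n + 2)) (l : Fin (n + 3)) (m : Fin (n + 1)),
      (face l q).1.2 m = faceArr l q m := fun _ _ _ => rfl
    simp only [faceArr, hk, Fin.val_castSucc, Fin.val_succ]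
    split_ifs
    all_goals first
      | rfl
      | omega
      | exact (if_pos (show (k : ℕ) + 1 < j by omega)).symm
      | skip
    rw [if_neg (show ¬ (k : ℕ) + 1 < j by omega), if_pos (show (k : ℕ) + 1 = j by omega)]
    simp only [show ¬ (k : ℕ) + 1 + 1 < i by omega, show ¬ (k : ℕ) + 1 + 1 = i by omega, if_false]
    exact G.mul_assoc (p.1.2 k.succ.succ) (p.1.2 k.succ.castSucc) (p.1.2 k.castSucc.castSucc) _ _

theorem smooth_face {n : ℕ} (i : Fin (n + 2)) :
    SmoothOnSubset (G.nerveModel (n + 1)) (G.nerveModel n) (G.nerve (n + 1))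
      (fun p => (face i p : G.NerveAmbient n)) := by
  have hobj : ∀ k : Fin (n + 2), SmoothOnSubset (G.nerveModel (n + 1)) (𝓡 G.dimObj)
      (G.nerve (n + 1)) (fun p => p.1.1 k) := fun k =>
    SmoothOnSubset.of_contMDiff ((contMDiff_eval_manifold k).comp contMDiff_fst)
  have harr : ∀ k : Fin (n + 1), SmoothOnSubset (G.nerveModel (n + 1)) (𝓡 G.dimArr)
      (G.nerve (n + 1)) (fun p => p.1.2 k) := fun k =>
    SmoothOnSubset.of_contMDiff ((contMDiff_eval_manifold k).comp contMDiff_snd)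
  refine SmoothOnSubset.prodMk (SmoothOnSubset.pi fun j => hobj _)
    (SmoothOnSubset.pi fun j => ?_)
  change SmoothOnSubset _ _ _ (fun p : G.nerve (n + 1) => faceArr i p j)
  simp only [faceArr]
  split_ifs
  · exact harr _
  · exact G.smooth_mul.comp (g := fun p : G.nerve (n + 1) =>
      ⟨(p.1.2 j.succ, p.1.2 j.castSucc), nerve_composable p j⟩) ((harr _).prodMk (harr _))
  · exact harr _

/-- The smooth functions on the space of strings of `n` composable arrows. -/
def Cochain (G : LieGroupoid.{u}) (n : ℕ) : Submodule ℝ (G.nerve n → ℝ) where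
  carrier := {f | SmoothOnSubset (G.nerveModel n) 𝓘(ℝ, ℝ) (G.nerve n) f}
  zero_mem' := SmoothOnSubset.of_contMDiff (f' := fun _ => (0 : ℝ)) contMDiff_const
  add_mem' hf hg := SmoothOnSubset.contMDiff_comp (J := 𝓘(ℝ, ℝ).prod 𝓘(ℝ, ℝ))
    (h := fun z : ℝ × ℝ => z.1 + z.2)
    (contMDiff_fst.add contMDiff_snd) (SmoothOnSubset.prodMk hf hg)
  smul_mem' c _ hf := SmoothOnSubset.contMDiff_comp (J := 𝓘(ℝ, ℝ)) (h := fun z : ℝ => c * z)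
    (contMDiff_const.mul contMDiff_id) hf

/-- The pullback of cochains along the `i`-th face map. -/
def coface {n : ℕ} (i : Fin (n + 2)) : G.Cochain n →ₗ[ℝ] G.Cochain (n + 1) where
  toFun f := ⟨fun p => f.1 (face i p), f.2.comp (smooth_face i)⟩
  map_add' _ _ := rfl
  map_smul' _ _ := rfl

/-- The simplicial differential `δ = ∑ (-1)ⁱ dᵢ^*`. -/
def differential (G : LieGroupoid.{u}) (n : ℕ) : G.Cochain n →ₗ[ℝ] G.Cochain (n + 1) :=
  ∑ i : Fin (n + 2), (-1 : ℝ) ^ (i : ℕ) • coface i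

theorem differential_apply (n : ℕ) (f : G.Cochain n) (p : G.nerve (n + 1)) :
    (G.differential n f).1 p = ∑ i : Fin (n + 2), (-1 : ℝ) ^ (i : ℕ) * f.1 (face i p) := by
  simp [differential, coface]

theorem differential_differential (n : ℕ) (f : G.Cochain n) :
    G.differential (n + 1) (G.differential n f) = 0 := by
  apply Subtype.ext
  funext p
  have key : ∑ j : Fin (n + 3), ∑ i : Fin (n + 2),
      (-1 : ℝ) ^ (j : ℕ) * ((-1 : ℝ) ^ (i : ℕ) * f.1 (face i (face j p))) = 0 := by
    rw [← Finset.sum_product', Finset.univ_product_univ]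
    refine Finset.sum_involution (fun ji _ =>
      if h : (ji.1 : ℕ) ≤ ji.2 then (ji.2.succ, ji.1.castLT (lt_of_le_of_lt h ji.2.2))
      else (ji.2.castSucc, ji.1.pred fun h0 => h (by simp [h0]))) ?_ ?_ ?_ ?_
    · rintro ⟨j, i⟩ -
      dsimp only
      split_ifs with h
      · have e := face_face (j.castLT (lt_of_le_of_lt h i.2)) i h p
        rw [Fin.castSucc_castLT] at e
        simp only [e, Fin.val_succ, Fin.val_castLT]
        ring
      · obtain ⟨j, rfl⟩ := Fin.exists_succ_eq.2 (show j ≠ 0 from fun h0 => h (by simp [h0]))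
        have e := face_face i j (Fin.le_def.2 (by have : ¬ ((j : ℕ) + 1 ≤ i) := h; omega)) p
        simp only [e, Fin.val_succ, Fin.pred_succ, Fin.val_castSucc]
        ring
    · rintro ⟨j, i⟩ - -
      dsimp only
      split_ifs with h
      · intro e
        have := congrArg (fun z => (z.1 : ℕ)) e
        simp at this
        omega
      · intro e
        have := congrArg (fun z => (z.1 : ℕ)) e
        simp at this
        omega
    · intros
      exact Finset.mem_univ _
    · rintro ⟨j, i⟩ -
      dsimp only
      split_ifs with h h' h'
      all_goals simp only [Fin.val_succ, Fin.val_castLT, Fin.val_castSucc, Fin.val_pred] at h'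
      · omega
      · rfl
      · simp
      · omega
  simp only [differential_apply, Finset.mul_sum]
  exact key

/-- The groupoid cochain complex of a Lie groupoid, formed by the smooth functions on its nerve with
the simplicial differential. -/
noncomputable def cochainComplex (G : LieGroupoid.{u}) : CochainComplex (ModuleCat.{u} ℝ) ℕ :=
  CochainComplex.of (fun n => ModuleCat.of ℝ (G.Cochain n))
    (fun n => ModuleCat.ofHom (G.differential n)) fun n => by
      refine ModuleCat.hom_ext (LinearMap.ext fun f => ?_)
      exact differential_differential n f

/-- The differentiable cohomology `Hⁿ` of a Lie groupoid, a real vector space. -/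
noncomputable abbrev cohomology (G : LieGroupoid.{u}) (n : ℕ) : ModuleCat.{u} ℝ :=
  G.cochainComplex.homology n

end LieGroupoid

/-!
A weak equivalence `F : H → G` has quasi-inverses over the members of an open cover of `G.Obj`: a
local section of the submersion `(g, x) ↦ tgt g` lifts objects of `G` to objects of `H` up to an
arrow, and full faithfulness lifts arrows. Different lifts differ by a natural isomorphism, so they
combine to a functor to `H` from the groupoid `G` with its objects labelled by members of the cover.
Averaging the pullback of cochains along this functor over all labels of the vertices of a string,
with the weights of a partition of unity, gives a cochain map. It is a homotopy inverse of `F^*`: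
both composites are averages of conjugations by local sections of a target map, and any two ways of
labelling are related by the prism operator, in particular the sections and the units.
-/

open scoped Topology

/-! ### The prism operator on tuples -/

section Prism

variable (R : Type*) [CommRing R] {A : Type*} [AddCommGroup A] [Module R A] {W : Type*} {m : ℕ}

/-- The `i`-th vertex path `(v₀, …, vᵢ, wᵢ, …, wₘ₋₁)` of the prism over a tuple of pairs
`zⱼ = (vⱼ, wⱼ)`. -/
def prismTuple (z : Fin m → W × W) (i : Fin m) (j : Fin (m + 1)) : W :=
  if j ≤ i.castSucc then (z (i.predAbove j)).1 else (z (i.predAbove j)).2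

/-- The simplicial differential `∑ᵢ (-1)ⁱ dᵢ^*` on functions of tuples, evaluated at the tuple
`v`. -/
def tupleDifferential (v : Fin (m + 1) → W) : ((Fin m → W) → A) →ₗ[R] A :=
  ∑ i : Fin (m + 1), (-1 : R) ^ (i : ℕ) • LinearMap.proj (v ∘ i.succAbove)

/-- The prism operator on functions of tuples: their alternating sum over the simplices of the prism
between the tuples of first and of second components of `z`. -/
def tuplePrism (z : Fin m → W × W) : ((Fin (m + 1) → W) → A) →ₗ[R] A :=
  ∑ i : Fin m, (-1 : R) ^ (i : ℕ) • LinearMap.proj (prismTuple z i)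

theorem tupleDifferential_apply (c : (Fin m → W) → A) (v : Fin (m + 1) → W) :
    tupleDifferential R v c = ∑ i : Fin (m + 1), (-1 : R) ^ (i : ℕ) • c (v ∘ i.succAbove) := by
  simp [tupleDifferential]

theorem tuplePrism_apply (c : (Fin (m + 1) → W) → A) (z : Fin m → W × W) :
    tuplePrism R z c = ∑ i : Fin m, (-1 : R) ^ (i : ℕ) • c (prismTuple z i) := by
  simp [tuplePrism]

theorem cons_comp_succAbove_zero (a : W) (v : Fin m → W) :
    (Fin.cons a v : Fin (m + 1) → W) ∘ Fin.succAbove 0 = v := by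
  funext j
  simp

theorem cons_comp_succAbove_succ (a : W) (v : Fin (m + 1) → W) (i : Fin (m + 1)) :
    (Fin.cons a v : Fin (m + 2) → W) ∘ i.succ.succAbove =
      (Fin.cons a (v ∘ i.succAbove) : Fin (m + 1) → W) := by
  funext j
  cases j using Fin.cases <;> simp

theorem prismTuple_cons_zero (x : W × W) (z : Fin m → W × W) :
    prismTuple (Fin.cons x z : Fin (m + 1) → W × W) 0 =
      Fin.cons x.1 (Fin.cons x.2 (Prod.snd ∘ z) : Fin (m + 1) → W) := by
  funext j
  cases j using Fin.cases with
  | zero => simp [prismTuple]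
  | succ j => cases j using Fin.cases <;> simp [prismTuple]

theorem prismTuple_cons_succ (x : W × W) (z : Fin m → W × W) (i : Fin m) :
    prismTuple (Fin.cons x z : Fin (m + 1) → W × W) i.succ =
      Fin.cons x.1 (prismTuple z i) := by
  funext j
  cases j using Fin.cases <;> simp [prismTuple]

theorem tupleDifferential_cons (c : (Fin (m + 1) → W) → A) (a : W) (v : Fin (m + 1) → W) :
    tupleDifferential R (Fin.cons a v : Fin (m + 2) → W) c =
      c v - tupleDifferential R v (fun t => c (Fin.cons a t : Fin (m + 1) → W)) := by
  simp only [tupleDifferential_apply, Fin.sum_univ_succ (n := m + 1), cons_comp_succAbove_zero,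
    cons_comp_succAbove_succ, Fin.val_zero, Fin.val_succ, pow_zero, one_smul, pow_succ, mul_neg_one,
    neg_smul, Finset.sum_neg_distrib, sub_eq_add_neg]

theorem tuplePrism_cons (c : (Fin (m + 2) → W) → A) (x : W × W) (z : Fin m → W × W) :
    tuplePrism R (Fin.cons x z : Fin (m + 1) → W × W) c =
      c (Fin.cons x.1 (Fin.cons x.2 (Prod.snd ∘ z) : Fin (m + 1) → W)) -
        tuplePrism R z (fun t => c (Fin.cons x.1 t : Fin (m + 2) → W)) := by
  simp only [tuplePrism_apply, Fin.sum_univ_succ (n := m), prismTuple_cons_zero,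
    prismTuple_cons_succ, Fin.val_zero, Fin.val_succ, pow_zero, one_smul, pow_succ, mul_neg_one,
    neg_smul, Finset.sum_neg_distrib, sub_eq_add_neg]

theorem tupleDifferential_comp {V : Type*} (f : V → W) (c : (Fin m → W) → A)
    (v : Fin (m + 1) → V) :
    tupleDifferential R v (fun t => c (f ∘ t)) = tupleDifferential R (f ∘ v) c := by
  simp only [tupleDifferential_apply, comp_assoc]

theorem comp_prismTuple {V : Type*} (f : V → W) (z : Fin m → V × V) (i : Fin m) :
    f ∘ prismTuple z i = prismTuple (Prod.map f f ∘ z) i :=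
  funext fun _ => apply_ite f _ _ _

theorem tuplePrism_comp {V : Type*} (f : V → W) (c : (Fin (m + 1) → W) → A)
    (z : Fin m → V × V) :
    tuplePrism R z (fun t => c (f ∘ t)) = tuplePrism R (Prod.map f f ∘ z) c := by
  simp only [tuplePrism_apply, comp_prismTuple]

theorem tuplePrism_tupleDifferential_cons (c : (Fin (m + 2) → W) → A) (x : W × W)
    (z : Fin (m + 1) → W × W) :
    tuplePrism R (Fin.cons x z : Fin (m + 2) → W × W) (fun t => tupleDifferential R t c) =
      c (Fin.cons x.2 (Prod.snd ∘ z) : Fin (m + 2) → W) -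
        c (Fin.cons x.1 (Prod.snd ∘ z) : Fin (m + 2) → W) +
        tupleDifferential R (Prod.snd ∘ z)
          (fun t => c (Fin.cons x.1 (Fin.cons x.2 t : Fin (m + 1) → W))) -
        tuplePrism R z c +
        tuplePrism R z
          (fun t => tupleDifferential R t (fun s => c (Fin.cons x.1 s : Fin (m + 2) → W))) := by
  rw [tuplePrism_cons, tupleDifferential_cons, tupleDifferential_cons]
  have : (fun t : Fin (m + 2) → W => tupleDifferential R (Fin.cons x.1 t : Fin (m + 3) → W) c) =
      c - fun t => tupleDifferential R t (fun s => c (Fin.cons x.1 s : Fin (m + 2) → W)) :=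
    funext fun t => tupleDifferential_cons R c x.1 t
  rw [this, map_sub]
  abel

theorem tupleDifferential_tuplePrism_cons (c : (Fin (m + 2) → W) → A) (x : W × W)
    (z : Fin (m + 1) → W × W) :
    tupleDifferential R (Fin.cons x z : Fin (m + 2) → W × W) (fun y => tuplePrism R y c) =
      tuplePrism R z c -
        tupleDifferential R (Prod.snd ∘ z)
          (fun t => c (Fin.cons x.1 (Fin.cons x.2 t : Fin (m + 1) → W))) +
        tupleDifferential R z
          (fun y => tuplePrism R y (fun s => c (Fin.cons x.1 s : Fin (m + 2) → W))) := by
  rw [tupleDifferential_cons, ← tupleDifferential_comp]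
  have : (fun y : Fin m → W × W => tuplePrism R (Fin.cons x y : Fin (m + 1) → W × W) c) =
      (fun y => c (Fin.cons x.1 (Fin.cons x.2 (Prod.snd ∘ y) : Fin (m + 1) → W))) -
        fun y => tuplePrism R y (fun s => c (Fin.cons x.1 s : Fin (m + 2) → W)) :=
    funext fun y => tuplePrism_cons R c x y
  rw [this, map_sub]
  abel

theorem tuplePrism_homotopy (c : (Fin (m + 1) → W) → A) (z : Fin (m + 1) → W × W) :
    tuplePrism R z (fun t => tupleDifferential R t c) +
      tupleDifferential R z (fun y => tuplePrism R y c) =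
    c (Prod.snd ∘ z) - c (Prod.fst ∘ z) := by
  induction m with
  | zero =>
    have hsnd : prismTuple z 0 ∘ Fin.succ = Prod.snd ∘ z := by
      funext j; simp [prismTuple, Subsingleton.elim j 0]
    have hfst : prismTuple z 0 ∘ Fin.succAbove 1 = Prod.fst ∘ z := by
      funext j; simp [prismTuple, Subsingleton.elim j 0]
    simp [tuplePrism_apply, tupleDifferential_apply, hsnd, hfst, sub_eq_add_neg]
  | succ m ih =>
    obtain ⟨x, z, rfl⟩ : ∃ x z', z = Fin.cons x z' := ⟨z 0, Fin.tail z, (Fin.cons_self_tail z).symm⟩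
    have hcons (p : W × W → W) : p ∘ (Fin.cons x z : Fin (m + 2) → W × W) =
        (Fin.cons (p x) (p ∘ z) : Fin (m + 2) → W) := Fin.comp_cons p x z
    have ihx := ih (fun t => c (Fin.cons x.1 t : Fin (m + 2) → W)) z
    rw [tuplePrism_tupleDifferential_cons, tupleDifferential_tuplePrism_cons, hcons, hcons]
    linear_combination (norm := abel) ihx

end Prism

/-! ### Averages over labels -/

section LabelAverage

variable {R : Type*} [CommSemiring R] {A : Type*} [AddCommMonoid A] [Module R A]
  {κ ι : Type*} [Fintype κ]

open Classical in
/-- The average of a function of a tuple of labels, when the `j`-th label is chosen, independently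
of the others, with the finitely supported weights `r j`. -/
noncomputable def labelAverage (r : κ → ι →₀ R) : ((κ → ι) → A) →ₗ[R] A :=
  ∑ a ∈ Fintype.piFinset fun j => (r j).support, (∏ j, r j (a j)) • LinearMap.proj a

theorem labelAverage_eq_sum [DecidableEq κ] {r : κ → ι →₀ R} {s : κ → Finset ι}
    (hs : ∀ j, (r j).support ⊆ s j) (φ : (κ → ι) → A) :
    labelAverage r φ = ∑ a ∈ Fintype.piFinset s, (∏ j, r j (a j)) • φ a := by
  classical
  have hdef : labelAverage r φ =
      ∑ a ∈ Fintype.piFinset fun j => (r j).support, (∏ j, r j (a j)) • φ a := by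
    simp only [labelAverage, LinearMap.sum_apply, LinearMap.smul_apply, LinearMap.proj_apply]
    congr!
  rw [hdef]
  refine Finset.sum_subset (Fintype.piFinset_subset _ _ hs) fun a _ ha => ?_
  obtain ⟨j, hj⟩ : ∃ j, r j (a j) = 0 := by simpa using ha
  rw [Finset.prod_eq_zero (Finset.mem_univ j) hj, zero_smul]

theorem labelAverage_const {r : κ → ι →₀ R} (hr : ∀ j, (r j).sum (fun _ w => w) = 1) (x : A) :
    labelAverage r (fun _ => x) = x := by
  classical
  rw [labelAverage_eq_sum fun _ => subset_rfl, ← Finset.sum_smul, ← Finset.prod_univ_sum,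
    Finset.prod_eq_one (f := fun j => ∑ i ∈ (r j).support, r j i) fun j _ => hr j, one_smul]

theorem labelAverage_comp_succAbove {n : ℕ} {r : Fin (n + 1) → ι →₀ R} (i : Fin (n + 1))
    (hr : (r i).sum (fun _ w => w) = 1) (φ : (Fin n → ι) → A) :
    labelAverage r (fun a => φ (a ∘ i.succAbove)) = labelAverage (r ∘ i.succAbove) φ := by
  classical
  have hsplit := Finset.filter_piFinset_eq_map_insertNthEquiv (p := i) (fun j => (r j).support)
    fun _ => True
  simp only [Finset.filter_true] at hsplit
  rw [labelAverage_eq_sum fun _ => subset_rfl, labelAverage_eq_sum fun _ => subset_rfl, hsplit,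
    Finset.sum_map, Finset.sum_product_right]
  refine Finset.sum_congr rfl fun a _ => ?_
  let ins (x : ι) : Fin (n + 1) → ι := i.insertNth (α := fun _ => ι) x a
  have hterm (x : ι) : (∏ j, r j (ins x j)) • φ (ins x ∘ i.succAbove) =
      r i x • (∏ j, r (i.succAbove j) (a j)) • φ a := by
    simp [ins, Fin.prod_univ_succAbove _ i, mul_smul, comp_def]
  calc ∑ x ∈ (r i).support, (∏ j, r j (ins x j)) • φ (ins x ∘ i.succAbove)
    _ = (r i).sum (fun _ w => w) • (∏ j, r (i.succAbove j) (a j)) • φ a := by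
      simp only [hterm, Finsupp.sum, Finset.sum_smul]
    _ = (∏ j, r (i.succAbove j) (a j)) • φ a := by rw [hr, one_smul]

end LabelAverage

/-! ### Smooth functions and partitions of unity -/

section SmoothOnSubset

variable {E : Type*} [NormedAddCommGroup E] [NormedSpace ℝ E] {H : Type*} [TopologicalSpace H]
  {E' : Type*} [NormedAddCommGroup E'] [NormedSpace ℝ E'] {H' : Type*} [TopologicalSpace H']
  {M : Type*} [TopologicalSpace M] [ChartedSpace H M]
  {E'' : Type*} [NormedAddCommGroup E''] [NormedSpace ℝ E''] {H'' : Type*} [TopologicalSpace H'']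
  {N : Type*} [TopologicalSpace N] [ChartedSpace H' N]
  {P : Type*} [TopologicalSpace P] [ChartedSpace H'' P]
  {I : ModelWithCorners ℝ E H} {J : ModelWithCorners ℝ E' H'} {K : ModelWithCorners ℝ E'' H''}
  {S T : Set M}

namespace SmoothOnSubset

theorem restrict {f : S → N} (hf : SmoothOnSubset I J S f) (hT : T ⊆ S) :
    SmoothOnSubset I J T (fun x => f ⟨x, hT x.2⟩) :=
  SmoothOnSubset.comp (h := f) (g := fun x : T => ⟨x, hT x.2⟩) hf (of_contMDiff contMDiff_id)

theorem of_contMDiffOn {f : M → N} (hS : IsOpen S) (hf : ContMDiffOn I J ∞ f S) :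
    SmoothOnSubset I J S (fun x => f x) :=
  fun x => ⟨S, hS, x.2, f, hf, fun _ _ => rfl⟩

theorem contMDiffOn {f : M → N} (hS : IsOpen S) (hf : SmoothOnSubset I J S (fun x => f x)) :
    ContMDiffOn I J ∞ f S := by
  intro x hx
  obtain ⟨U, hU, hxU, f', hf', hfU⟩ := hf ⟨x, hx⟩
  refine ((hf'.contMDiffAt (hU.mem_nhds hxU)).congr_of_eventuallyEq ?_).contMDiffWithinAt
  filter_upwards [hU.mem_nhds hxU, hS.mem_nhds hx] with y hyU hyS using (hfU ⟨y, hyS⟩ hyU).symm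

theorem contMDiffOn_comp {U : Set N} (hU : IsOpen U) {h : N → P} (hh : ContMDiffOn J K ∞ h U)
    {g : S → N} (hg : SmoothOnSubset I J S g) (hgU : ∀ x, g x ∈ U) :
    SmoothOnSubset I K S (fun x => h (g x)) :=
  SmoothOnSubset.comp (g := fun x => ⟨g x, hgU x⟩) (of_contMDiffOn hU hh) hg

theorem of_eventually_eq {f : S → N}
    (hf : ∀ x : S, ∃ g : S → N, SmoothOnSubset I J S g ∧
      ∀ᶠ y : M in 𝓝 x, ∀ hy : y ∈ S, g ⟨y, hy⟩ = f ⟨y, hy⟩) :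
    SmoothOnSubset I J S f := by
  intro x
  obtain ⟨g, hg, hgf⟩ := hf x
  obtain ⟨U, hgfU, hU, hxU⟩ := eventually_nhds_iff.1 hgf
  obtain ⟨V, hV, hxV, f', hf', hfg⟩ := hg x
  exact ⟨U ∩ V, hU.inter hV, ⟨hxU, hxV⟩, f', hf'.mono inter_subset_right,
    fun y hy => (hfg y hy.2).trans (hgfU y hy.1 y.2)⟩

theorem const_mul {f : S → ℝ} (c : ℝ) (hf : SmoothOnSubset I 𝓘(ℝ, ℝ) S f) :
    SmoothOnSubset I 𝓘(ℝ, ℝ) S (fun x => c * f x) :=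
  contMDiff_comp (J := 𝓘(ℝ, ℝ)) (h := fun z : ℝ => c * z) (contMDiff_const.mul contMDiff_id) hf

theorem sum {κ : Type*} [Finite κ] {f : κ → S → ℝ}
    (hf : ∀ a, SmoothOnSubset I 𝓘(ℝ, ℝ) S (f a)) (s : Finset κ) :
    SmoothOnSubset I 𝓘(ℝ, ℝ) S (fun x => ∑ a ∈ s, f a x) := by
  cases nonempty_fintype κ
  exact contMDiff_comp (J := ModelWithCorners.pi fun _ : κ => 𝓘(ℝ, ℝ))
    (h := fun z : κ → ℝ => ∑ a ∈ s, z a)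
    (contMDiff_finsetSum fun a _ => contMDiff_eval_manifold a) (SmoothOnSubset.pi hf)

theorem mul_of_tsupport_subset {O : Set M} (hO : IsOpen O) {r : M → ℝ}
    (hr : ContMDiff I 𝓘(ℝ, ℝ) ∞ r) (hrO : tsupport r ⊆ O) {φ : S → ℝ}
    (hφ : SmoothOnSubset I 𝓘(ℝ, ℝ) (S ∩ O) (fun x => φ ⟨x, x.2.1⟩)) :
    SmoothOnSubset I 𝓘(ℝ, ℝ) S (fun x => r x * φ x) := by
  intro x
  by_cases hx : (x : M) ∈ O
  · obtain ⟨U, hU, hxU, f', hf', hfU⟩ := hφ ⟨x, x.2, hx⟩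
    refine ⟨U ∩ O, hU.inter hO, ⟨hxU, hx⟩, fun y => r y * f' y,
      hr.contMDiffOn.mul (hf'.mono inter_subset_left), fun y hy => ?_⟩
    dsimp only
    rw [hfU ⟨y, y.2, hy.2⟩ hy.1]
  · refine ⟨(tsupport r)ᶜ, (isClosed_tsupport r).isOpen_compl, fun h => hx (hrO h), fun _ => 0,
      contMDiffOn_const, fun y hy => ?_⟩
    simp only [image_eq_zero_of_notMem_tsupport hy, zero_mul]

end SmoothOnSubset

end SmoothOnSubset

section PartitionOfUnity

variable {E : Type*} [NormedAddCommGroup E] [NormedSpace ℝ E] {H : Type*} [TopologicalSpace H]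
  {E' : Type*} [NormedAddCommGroup E'] [NormedSpace ℝ E'] {H' : Type*} [TopologicalSpace H']
  {M : Type*} [TopologicalSpace M] [ChartedSpace H M]
  {N : Type*} [TopologicalSpace N] [ChartedSpace H' N]
  {I : ModelWithCorners ℝ E H} {J : ModelWithCorners ℝ E' H'} {ι : Type*}

/-- The finitely many nonzero weights at the point `x` of the labels of a partition of unity. -/
noncomputable def partitionWeights {s : Set N} (ρ : SmoothPartitionOfUnity ι J N s) (x : N) :
    ι →₀ ℝ where
  support := ρ.finsupport x
  toFun i := ρ i x
  mem_support_toFun _ := ρ.mem_finsupport x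

theorem sum_partitionWeights {s : Set N} (ρ : SmoothPartitionOfUnity ι J N s) {x : N} (hx : x ∈ s) :
    (partitionWeights ρ x).sum (fun _ w => w) = 1 :=
  ρ.sum_finsupport x hx

/-- The pullback of a partition of unity along a smooth map. -/
noncomputable def pullbackPartition (ρ : SmoothPartitionOfUnity ι J N univ) {f : M → N}
    (hf : ContMDiff I J ∞ f) : SmoothPartitionOfUnity ι I M univ where
  toFun i := (ρ i).comp ⟨f, hf⟩
  locallyFinite' := ρ.locallyFinite.preimage_continuous hf.continuous
  nonneg' i x := ρ.nonneg i (f x)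
  sum_eq_one' x _ := ρ.sum_eq_one (mem_univ (f x))
  sum_le_one' x := ρ.sum_le_one (f x)

theorem isSubordinate_pullbackPartition {ρ : SmoothPartitionOfUnity ι J N univ} {U : ι → Set N}
    (hρ : ρ.IsSubordinate U) {f : M → N} (hf : ContMDiff I J ∞ f) :
    (pullbackPartition ρ hf).IsSubordinate fun i => f ⁻¹' U i := fun i =>
  (tsupport_comp_subset_preimage (ρ i) hf.continuous).trans (preimage_mono (hρ i))

theorem tsupport_prod_subset {X κ : Type*} [TopologicalSpace X] [Fintype κ] (f : κ → X → ℝ) :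
    tsupport (fun x => ∏ j, f j x) ⊆ ⋂ j, tsupport (f j) := by
  refine closure_minimal (fun x hx => mem_iInter.2 fun j => subset_tsupport _ fun hj => hx ?_)
    (isClosed_iInter fun j => isClosed_tsupport (f j))
  exact Finset.prod_eq_zero (Finset.mem_univ j) hj

theorem smooth_labelAverage {κ : Type*} [Fintype κ] {s : Set N}
    (ρ : SmoothPartitionOfUnity ι J N s)
    {U : ι → Set N} (hU : ∀ i, IsOpen (U i)) (hρ : ρ.IsSubordinate U) {v : κ → M → N}
    (hv : ∀ j, ContMDiff I J ∞ (v j)) {S : Set M} {φ : (κ → ι) → S → ℝ}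
    (hφ : ∀ a, SmoothOnSubset I 𝓘(ℝ, ℝ) (S ∩ {x | ∀ j, v j x ∈ U (a j)})
      (fun x => φ a ⟨x, x.2.1⟩)) :
    SmoothOnSubset I 𝓘(ℝ, ℝ) S
      (fun x => labelAverage (fun j => partitionWeights ρ (v j x)) fun a => φ a x) := by
  classical
  have hterm (a : κ → ι) :
      SmoothOnSubset I 𝓘(ℝ, ℝ) S (fun x => (∏ j, ρ (a j) (v j x)) * φ a x) := by
    refine SmoothOnSubset.mul_of_tsupport_subset (r := fun x => ∏ j, ρ (a j) (v j x)) ?_ ?_ ?_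
      (hφ a)
    · simp only [ofPred_forall]
      exact isOpen_iInter_of_finite fun j => (hU (a j)).preimage (hv j).continuous
    · exact contMDiff_finsetProd fun j _ => (ρ (a j)).contMDiff.comp (hv j)
    · exact fun x hx j => hρ (a j) <| tsupport_comp_subset_preimage (ρ (a j)) (hv j).continuous <|
        mem_iInter.1 (tsupport_prod_subset (fun j x => ρ (a j) (v j x)) hx) j
  refine SmoothOnSubset.of_eventually_eq fun x => ?_
  have hsupp : ∀ᶠ y in 𝓝 (x : M), ∀ j, ρ.finsupport (v j y) ⊆ ρ.fintsupport (v j x) :=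
    Filter.eventually_all.2 fun j =>
      (hv j).continuous.continuousAt.eventually (ρ.eventually_finsupport_subset (v j x))
  refine ⟨_, SmoothOnSubset.sum (fun a : Fintype.piFinset fun j => ρ.fintsupport (v j x) =>
    hterm a) Finset.univ, hsupp.mono fun y hy hyS => ?_⟩
  exact (Finset.sum_coe_sort _ fun a => (∏ j, ρ (a j) (v j y)) * φ a ⟨y, hyS⟩).trans
    (labelAverage_eq_sum (r := fun j => partitionWeights ρ (v j y)) hy
      fun a => φ a ⟨y, hyS⟩).symm

end PartitionOfUnity

/-! ### Local sections of submersions from fibre products -/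

section LocalSections

theorem eventually_fibreProduct {M₁ M₂ B N : Type*} [TopologicalSpace M₁] [TopologicalSpace M₂]
    [TopologicalSpace B] [TopologicalSpace N] {s : M₁ → B} {f : M₂ → B} {t : M₁ → N} {x₁ : M₁}
    {x₂ : M₂} (hs : Continuous s) (hf : Continuous f) (ht : Continuous t) (hx : s x₁ = f x₂)
    {p : B → Prop} (hp : ∀ᶠ b in 𝓝 (s x₁), p b) {q : N → Prop} (hq : ∀ᶠ y in 𝓝 (t x₁), q y) :
    ∀ᶠ z in 𝓝 (x₁, x₂), (p (s z.1) ∧ p (f z.2)) ∧ q (t z.1) :=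
  (((hs.comp continuous_fst).tendsto (x₁, x₂)).eventually hp |>.and <|
    ((hf.comp continuous_snd).tendsto' (x₁, x₂) (s x₁) hx.symm).eventually hp).and <|
    ((ht.comp continuous_fst).tendsto (x₁, x₂)).eventually hq

variable {E : Type*} [NormedAddCommGroup E] [NormedSpace ℝ E]
  {F : Type*} [NormedAddCommGroup F] [NormedSpace ℝ F] {n : WithTop ℕ∞}

theorem exists_local_inverse_of_hasFDerivAt_equiv [CompleteSpace E] {f : E → F} {a : E}
    (hn : n ≠ 0) (hf : ∀ᶠ x in 𝓝 a, ContDiffAt ℝ n f x) {f' : E ≃L[ℝ] F}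
    (hf' : HasFDerivAt f (f' : E →L[ℝ] F) a) :
    ∃ s : F → E, s (f a) = a ∧ ∀ᶠ y in 𝓝 (f a), ContDiffAt ℝ n s y ∧ f (s y) = y := by
  have hfa := hf.self_of_nhds
  let e := hfa.toOpenPartialHomeomorph f hf' hn
  have ha : a ∈ e.source := hfa.mem_toOpenPartialHomeomorph_source hf' hn
  have hfderiv : ∀ᶠ x in 𝓝 a, fderiv ℝ f x ∈ range ((↑) : (E ≃L[ℝ] F) → E →L[ℝ] F) :=
    (hfa.continuousAt_fderiv hn).eventually_mem
      (ContinuousLinearEquiv.isOpen.mem_nhds ⟨f', hf'.fderiv.symm⟩)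
  refine ⟨e.symm, e.left_inv ha, ?_⟩
  filter_upwards [(e.tendsto_symm ha).eventually (hf.and hfderiv), e.open_target.mem_nhds
    (e.map_source ha)] with y ⟨hfy, g', hg'⟩ hy
  refine ⟨e.contDiffAt_symm (f₀' := g') hy ?_ hfy, e.right_inv hy⟩
  rw [hg']
  exact (hfy.differentiableAt hn).hasFDerivAt

theorem exists_local_section_of_hasFDerivAt_surjective [FiniteDimensional ℝ F] {f : E → F} {a : E}
    (hn : n ≠ 0) (hf : ∀ᶠ x in 𝓝 a, ContDiffAt ℝ n f x) {f' : E →L[ℝ] F} (hf' : HasFDerivAt f f' a)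
    (hsurj : Surjective f') :
    ∃ s : F → E, s (f a) = a ∧ ∀ᶠ y in 𝓝 (f a), ContDiffAt ℝ n s y ∧ f (s y) = y := by
  have : CompleteSpace F := FiniteDimensional.complete ℝ F
  obtain ⟨R, hR⟩ :=
    f'.toLinearMap.exists_rightInverse_of_surjective (LinearMap.range_eq_top.2 hsurj)
  let r : F →L[ℝ] E := LinearMap.toContinuousLinearMap R
  let j : F → E := fun w => a + r w
  have hj : ContDiff ℝ n j := contDiff_const.add r.contDiff
  have hj0 : j 0 = a := by simp [j]
  have hfj : ∀ᶠ w in 𝓝 0, ContDiffAt ℝ n (f ∘ j) w :=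
    (hj.continuous.tendsto' 0 a hj0).eventually hf |>.mono fun w hw => hw.comp w hj.contDiffAt
  have hfj' : HasFDerivAt (f ∘ j) (ContinuousLinearEquiv.refl ℝ F : F →L[ℝ] F) 0 := by
    rw [← hj0] at hf'
    exact (hf'.comp 0 (r.hasFDerivAt.const_add a)).congr_fderiv
      (ContinuousLinearMap.ext fun w => LinearMap.congr_fun hR w)
  obtain ⟨s, hs0, hs⟩ := exists_local_inverse_of_hasFDerivAt_equiv hn hfj hfj'
  rw [comp_apply, hj0] at hs hs0
  exact ⟨j ∘ s, by rw [comp_apply, hs0, hj0],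
    hs.mono fun y hy => ⟨hj.contDiffAt.comp y hy.1, hy.2⟩⟩

variable {X : Type*} [TopologicalSpace X] {I : ModelWithCorners ℝ E X}
  {M : Type*} [TopologicalSpace M] [ChartedSpace X M]

theorem exists_local_section_of_mfderiv_surjective [I.Boundaryless] [IsManifold I n M]
    [FiniteDimensional ℝ F] {f : M → F} {x : M} (hn : n ≠ 0)
    (hf : ∀ᶠ z in 𝓝 x, ContMDiffAt I 𝓘(ℝ, F) n f z)
    (hsurj : Surjective (mfderiv I 𝓘(ℝ, F) f x)) :
    ∃ s : F → M, s (f x) = x ∧ ∀ᶠ y in 𝓝 (f x), ContMDiffAt 𝓘(ℝ, F) I n s y ∧ f (s y) = y := by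
  let φ := extChartAt I x
  have hφx : φ.symm (φ x) = x := extChartAt_to_inv x
  have htarget : ∀ᶠ v in 𝓝 (φ x), v ∈ φ.target :=
    (isOpen_extChartAt_target x).mem_nhds (mem_extChartAt_target x)
  have hsymm {v : E} (hv : v ∈ φ.target) : ContMDiffAt 𝓘(ℝ, E) I n φ.symm v :=
    (contMDiffOn_extChartAt_symm x).contMDiffAt ((isOpen_extChartAt_target x).mem_nhds hv)
  have hfφ : ∀ᶠ v in 𝓝 (φ x), ContDiffAt ℝ n (f ∘ φ.symm) v := by
    have htendsto : Filter.Tendsto φ.symm (𝓝 (φ x)) (𝓝 (φ.symm (φ x))) :=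
      continuousAt_extChartAt_symm x
    rw [hφx] at htendsto
    filter_upwards [htendsto.eventually hf, htarget] with v hv hvt
    exact (hv.comp v (hsymm hvt)).contDiffAt
  have hfφ' : HasFDerivAt (f ∘ φ.symm) (mfderiv I 𝓘(ℝ, F) f x : E →L[ℝ] F) (φ x) := by
    have h := (hf.self_of_nhds.mdifferentiableAt hn).hasMFDerivAt.2
    rw [I.range_eq_univ] at h
    exact h.hasFDerivAt_of_univ
  obtain ⟨s, hsx, hs⟩ := exists_local_section_of_hasFDerivAt_surjective hn hfφ hfφ' hsurj
  rw [Function.comp_apply, hφx] at hsx hs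
  have hs_target : ∀ᶠ y in 𝓝 (f x), s y ∈ φ.target :=
    hs.self_of_nhds.1.continuousAt.eventually (by rwa [hsx])
  refine ⟨φ.symm ∘ s, by rw [Function.comp_apply, hsx, hφx], ?_⟩
  filter_upwards [hs, hs_target] with y hy hyt
  exact ⟨(hsymm hyt).comp y hy.1.contMDiffAt, hy.2⟩

variable {X₁ : Type*} [TopologicalSpace X₁] {E₁ : Type*} [NormedAddCommGroup E₁] [NormedSpace ℝ E₁]
  {I₁ : ModelWithCorners ℝ E₁ X₁} {M₁ : Type*} [TopologicalSpace M₁] [ChartedSpace X₁ M₁]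
  {X₂ : Type*} [TopologicalSpace X₂] {E₂ : Type*} [NormedAddCommGroup E₂] [NormedSpace ℝ E₂]
  {I₂ : ModelWithCorners ℝ E₂ X₂} {M₂ : Type*} [TopologicalSpace M₂] [ChartedSpace X₂ M₂]
  {Y : Type*} [TopologicalSpace Y] {F : Type*} [NormedAddCommGroup F] [NormedSpace ℝ F]
  {J : ModelWithCorners ℝ F Y} {B : Type*} [TopologicalSpace B] [ChartedSpace Y B]
  {Y' : Type*} [TopologicalSpace Y'] {F' : Type*} [NormedAddCommGroup F'] [NormedSpace ℝ F']
  {J' : ModelWithCorners ℝ F' Y'} {N : Type*} [TopologicalSpace N] [ChartedSpace Y' N]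

theorem mfderiv_sub_prodMk_surjective {s : M₁ → F} {f : M₂ → F} {t : M₁ → F'} {x₁ : M₁} {x₂ : M₂}
    (hs : MDifferentiableAt I₁ 𝓘(ℝ, F) s x₁) (hf : MDifferentiableAt I₂ 𝓘(ℝ, F) f x₂)
    (ht : MDifferentiableAt I₁ 𝓘(ℝ, F') t x₁) (hsurj : Surjective (mfderiv I₁ 𝓘(ℝ, F) s x₁))
    (htrans : ∀ w : F', ∃ (u : TangentSpace I₁ x₁) (v : TangentSpace I₂ x₂),
      (mfderiv I₁ 𝓘(ℝ, F) s x₁ u : F) = mfderiv I₂ 𝓘(ℝ, F) f x₂ v ∧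
      mfderiv I₁ 𝓘(ℝ, F') t x₁ u = w) :
    Surjective (mfderiv (I₁.prod I₂) 𝓘(ℝ, F × F')
      (fun z : M₁ × M₂ => (s z.1 - f z.2, t z.1)) (x₁, x₂)) := by
  have hsub := (hs.hasMFDerivAt.comp (x₁, x₂) (hasMFDerivAt_fst (I := I₁) (I' := I₂) _)).sub
    (hf.hasMFDerivAt.comp (x₁, x₂) (hasMFDerivAt_snd _))
  have ht := ht.hasMFDerivAt.comp (x₁, x₂) (hasMFDerivAt_fst (I := I₁) (I' := I₂) _)
  have hderiv : HasMFDerivAt (I₁.prod I₂) 𝓘(ℝ, F × F')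
      (fun z : M₁ × M₂ => (s z.1 - f z.2, t z.1)) (x₁, x₂) _ :=
    ⟨hsub.1.prodMk ht.1, hsub.2.prodMk ht.2⟩
  let Ds : E₁ →L[ℝ] F := mfderiv I₁ 𝓘(ℝ, F) s x₁
  let Df : E₂ →L[ℝ] F := mfderiv I₂ 𝓘(ℝ, F) f x₂
  let Dt : E₁ →L[ℝ] F' := mfderiv I₁ 𝓘(ℝ, F') t x₁
  intro ⟨a, b⟩
  obtain ⟨u₀, hu₀⟩ : ∃ u₀, Ds u₀ = a := hsurj a
  obtain ⟨u, v, huv, hu⟩ : ∃ u v, Ds u = Df v ∧ Dt u = b - Dt u₀ := htrans (b - Dt u₀)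
  have hfst : Ds (u + u₀) - Df v = a := by rw [map_add, hu₀, huv, add_sub_cancel_left]
  have hsnd : Dt (u + u₀) = b := by rw [map_add, hu, sub_add_cancel]
  exact ⟨(u + u₀, v), (DFunLike.congr_fun hderiv.mfderiv _).trans (Prod.ext hfst hsnd)⟩

theorem mfderiv_comp_sub_prodMk_comp_surjective {s : M₁ → B} {f : M₂ → B} {t : M₁ → N}
    {x₁ : M₁} {x₂ : M₂} (hs : MDifferentiableAt I₁ J s x₁) (hf : MDifferentiableAt I₂ J f x₂)
    (ht : MDifferentiableAt I₁ J' t x₁) (hx : s x₁ = f x₂) (hsurj : Surjective (mfderiv I₁ J s x₁))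
    (htrans : ∀ w : TangentSpace J' (t x₁), ∃ (u : TangentSpace I₁ x₁) (v : TangentSpace I₂ x₂),
      tangentMap I₁ J s ⟨x₁, u⟩ = tangentMap I₂ J f ⟨x₂, v⟩ ∧ mfderiv I₁ J' t x₁ u = w)
    {ψ : B → F} (hψ : MDifferentiableAt J 𝓘(ℝ, F) ψ (s x₁))
    (hψ_surj : Surjective (mfderiv J 𝓘(ℝ, F) ψ (s x₁)))
    {χ : N → F'} (hχ : MDifferentiableAt J' 𝓘(ℝ, F') χ (t x₁))
    (hχ_surj : Surjective (mfderiv J' 𝓘(ℝ, F') χ (t x₁))) :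
    Surjective (mfderiv (I₁.prod I₂) 𝓘(ℝ, F × F')
      (fun z : M₁ × M₂ => (ψ (s z.1) - ψ (f z.2), χ (t z.1))) (x₁, x₂)) := by
  have hψf : MDifferentiableAt J 𝓘(ℝ, F) ψ (f x₂) := hx ▸ hψ
  refine mfderiv_sub_prodMk_surjective (hψ.comp x₁ hs) (hψf.comp x₂ hf) (hχ.comp x₁ ht) ?_ ?_
  · rw [mfderiv_comp x₁ hψ hs]
    exact hψ_surj.comp hsurj
  · intro w
    obtain ⟨w, rfl⟩ := hχ_surj w
    obtain ⟨u, v, huv, rfl⟩ := htrans w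
    refine ⟨u, v, ?_, DFunLike.congr_fun (mfderiv_comp x₁ hχ ht) u⟩
    have htangent := congrArg (tangentMap J 𝓘(ℝ, F) ψ) huv
    rw [← tangentMap_comp_at ⟨x₁, u⟩ hψ hs, ← tangentMap_comp_at ⟨x₂, v⟩ hψf hf] at htangent
    exact eq_of_heq (Bundle.TotalSpace.mk.inj htangent).2

theorem eventually_contMDiffAt_comp_sub_prodMk_comp {s : M₁ → B} {f : M₂ → B} {t : M₁ → N}
    {x₁ : M₁} {x₂ : M₂} (hs : ContMDiff I₁ J n s) (hf : ContMDiff I₂ J n f)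
    (ht : ContMDiff I₁ J' n t) (hx : s x₁ = f x₂) {ψ : B → F}
    (hψ : ∀ᶠ b in 𝓝 (s x₁), ContMDiffAt J 𝓘(ℝ, F) n ψ b) {χ : N → F'}
    (hχ : ∀ᶠ y in 𝓝 (t x₁), ContMDiffAt J' 𝓘(ℝ, F') n χ y) :
    ∀ᶠ z in 𝓝 (x₁, x₂), ContMDiffAt (I₁.prod I₂) 𝓘(ℝ, F × F') n
      (fun z : M₁ × M₂ => (ψ (s z.1) - ψ (f z.2), χ (t z.1))) z := by
  filter_upwards [eventually_fibreProduct hs.continuous hf.continuous ht.continuous hx hψ hχ]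
    with z ⟨⟨hsz, hfz⟩, htz⟩
  exact ((hsz.comp z (hs.comp contMDiff_fst).contMDiffAt).sub
    (hfz.comp z (hf.comp contMDiff_snd).contMDiffAt)).prodMk_space
    (htz.comp z (ht.comp contMDiff_fst).contMDiffAt)

theorem exists_local_section_fibreProduct [I₁.Boundaryless] [I₂.Boundaryless] [IsManifold I₁ n M₁]
    [IsManifold I₂ n M₂] [IsManifold J n B] [IsManifold J' n N] [FiniteDimensional ℝ F]
    [FiniteDimensional ℝ F'] {s : M₁ → B} {f : M₂ → B} {t : M₁ → N} {x₁ : M₁} {x₂ : M₂}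
    (hn : n ≠ 0) (hs : ContMDiff I₁ J n s) (hf : ContMDiff I₂ J n f) (ht : ContMDiff I₁ J' n t)
    (hx : s x₁ = f x₂) (hsurj : Surjective (mfderiv I₁ J s x₁))
    (htrans : ∀ w : TangentSpace J' (t x₁), ∃ (u : TangentSpace I₁ x₁) (v : TangentSpace I₂ x₂),
      tangentMap I₁ J s ⟨x₁, u⟩ = tangentMap I₂ J f ⟨x₂, v⟩ ∧ mfderiv I₁ J' t x₁ u = w) :
    ∃ σ : N → M₁ × M₂, ∀ᶠ y in 𝓝 (t x₁), ContMDiffAt J' (I₁.prod I₂) n σ y ∧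
      s (σ y).1 = f (σ y).2 ∧ t (σ y).1 = y := by
  have : IsManifold J 1 B := .of_le (ENat.one_le_iff_ne_zero_withTop.2 hn)
  have : IsManifold J' 1 N := .of_le (ENat.one_le_iff_ne_zero_withTop.2 hn)
  let ψ := extChartAt J (s x₁)
  let χ := extChartAt J' (t x₁)
  have hψ {b : B} (hb : b ∈ ψ.source) : ContMDiffAt J 𝓘(ℝ, F) n ψ b :=
    contMDiffAt_extChartAt' ((extChartAt_source J (s x₁)).subset hb)
  have hχ {y : N} (hy : y ∈ χ.source) : ContMDiffAt J' 𝓘(ℝ, F') n χ y :=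
    contMDiffAt_extChartAt' ((extChartAt_source J' (t x₁)).subset hy)
  have hsx : s x₁ ∈ ψ.source := mem_extChartAt_source _
  have htx : t x₁ ∈ χ.source := mem_extChartAt_source _
  have hψ_src : ∀ᶠ b in 𝓝 (s x₁), b ∈ ψ.source := extChartAt_source_mem_nhds _
  have hχ_src : ∀ᶠ y in 𝓝 (t x₁), y ∈ χ.source := extChartAt_source_mem_nhds _
  have hsource := eventually_fibreProduct hs.continuous hf.continuous ht.continuous hx hψ_src hχ_src
  let Θ : M₁ × M₂ → F × F' := fun z => (ψ (s z.1) - ψ (f z.2), χ (t z.1))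
  have hΘ : ∀ᶠ z in 𝓝 (x₁, x₂), ContMDiffAt (I₁.prod I₂) 𝓘(ℝ, F × F') n Θ z :=
    eventually_contMDiffAt_comp_sub_prodMk_comp hs hf ht hx (hψ_src.mono fun _ => hψ)
      (hχ_src.mono fun _ => hχ)
  have hΘ_surj : Surjective (mfderiv (I₁.prod I₂) 𝓘(ℝ, F × F') Θ (x₁, x₂)) :=
    mfderiv_comp_sub_prodMk_comp_surjective ((hs _).mdifferentiableAt hn)
      ((hf _).mdifferentiableAt hn) ((ht _).mdifferentiableAt hn) hx hsurj htrans
      ((hψ hsx).mdifferentiableAt hn) (isInvertible_mfderiv_extChartAt hsx).bijective.surjective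
      ((hχ htx).mdifferentiableAt hn) (isInvertible_mfderiv_extChartAt htx).bijective.surjective
  obtain ⟨τ, hτx, hτ⟩ := exists_local_section_of_mfderiv_surjective hn hΘ hΘ_surj
  have hτ_source := hτ.self_of_nhds.1.continuousAt.tendsto.eventually (hτx.symm ▸ hsource)
  have hΘx : Θ (x₁, x₂) = (0, χ (t x₁)) := by simp only [Θ, hx, sub_self]
  rw [hΘx] at hτ hτ_source
  let j : N → F × F' := fun y => (0, χ y)
  have hj {y : N} (hy : y ∈ χ.source) : ContMDiffAt J' 𝓘(ℝ, F × F') n j y :=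
    contMDiffAt_const.prodMk_space (hχ hy)
  refine ⟨τ ∘ j, ?_⟩
  filter_upwards [(hj htx).continuousAt.tendsto.eventually (hτ.and hτ_source), hχ_src]
    with y ⟨⟨hτy, hΘy⟩, ⟨hsy, hfy⟩, hty⟩ hy
  exact ⟨hτy.comp y (hj hy), ψ.injOn hsy hfy (sub_eq_zero.1 (congrArg Prod.fst hΘy)),
    χ.injOn hty hy (congrArg Prod.snd hΘy)⟩

end LocalSections

namespace LieGroupoid

theorem SmoothlyEssentiallySurjective.exists_local_section {G : LieGroupoid.{u}} {d : ℕ}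
    {N : Type u} [TopologicalSpace N] [ChartedSpace (EuclideanSpace ℝ (Fin d)) N]
    [IsManifold (𝓡 d) ∞ N] {f : N → G.Obj} (hf : ContMDiff (𝓡 d) (𝓡 G.dimObj) ∞ f)
    (h : G.SmoothlyEssentiallySurjective (d := d) f) (y : G.Obj) :
    ∃ σ : G.Obj → G.Arr × N, ∀ᶠ z in 𝓝 y,
      ContMDiffAt (𝓡 G.dimObj) ((𝓡 G.dimArr).prod (𝓡 d)) ∞ σ z ∧
      G.src (σ z).1 = f (σ z).2 ∧ G.tgt (σ z).1 = z := by
  obtain ⟨g, x, hgx, rfl⟩ := h.1 y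
  exact exists_local_section_fibreProduct (by simp) G.smooth_src hf G.smooth_tgt hgx
    (G.submersion_src g) (h.2 g x hgx)

end LieGroupoid

/-! ### Strings of composable arrows -/

namespace LieGroupoid

variable {G H : LieGroupoid.{u}}

section Comp

open Classical in
/-- The composite `g h` as a total function of two arrows: the first arrow is returned as a junk
value if the two are not composable. -/
noncomputable def comp (G : LieGroupoid.{u}) (g h : G.Arr) : G.Arr :=
  if e : G.src g = G.tgt h then G.mul ⟨(g, h), e⟩ else g

variable {g h k : G.Arr}

theorem comp_eq_mul (e : G.src g = G.tgt h) : G.comp g h = G.mul ⟨(g, h), e⟩ := dif_pos e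

theorem src_comp (e : G.src g = G.tgt h) : G.src (G.comp g h) = G.src h := by
  rw [comp_eq_mul e, G.src_mul]

theorem tgt_comp (e : G.src g = G.tgt h) : G.tgt (G.comp g h) = G.tgt g := by
  rw [comp_eq_mul e, G.tgt_mul]

theorem comp_assoc (e : G.src g = G.tgt h) (e' : G.src h = G.tgt k) :
    G.comp (G.comp g h) k = G.comp g (G.comp h k) := by
  rw [comp_eq_mul (by rw [src_comp e, e']), comp_eq_mul (h := G.comp h k) (by rw [tgt_comp e', e])]
  simp only [comp_eq_mul e, comp_eq_mul e']
  exact G.mul_assoc g h k e e'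

theorem comp_unit {x : G.Obj} (e : G.src g = x) : G.comp g (G.unit x) = g := by
  subst e
  rw [comp_eq_mul (G.tgt_unit _).symm, G.mul_unit]

theorem unit_comp {x : G.Obj} (e : G.tgt g = x) : G.comp (G.unit x) g = g := by
  subst e
  rw [comp_eq_mul (G.src_unit _), G.unit_mul]

theorem comp_inv (g : G.Arr) : G.comp g (G.inv g) = G.unit (G.tgt g) := by
  rw [comp_eq_mul (G.tgt_inv g).symm, G.mul_inv]

theorem inv_comp (g : G.Arr) : G.comp (G.inv g) g = G.unit (G.src g) := by
  rw [comp_eq_mul (G.src_inv g), G.inv_mul]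

theorem inv_comp_cancel (e : G.src g = G.tgt h) : G.comp (G.inv g) (G.comp g h) = h := by
  rw [← comp_assoc (G.src_inv g) e, inv_comp, unit_comp e.symm]

theorem comp_inv_cancel (e : G.tgt g = G.tgt h) : G.comp g (G.comp (G.inv g) h) = h := by
  rw [← comp_assoc (G.tgt_inv g).symm ((G.src_inv g).trans e), comp_inv, unit_comp e.symm]

theorem inv_eq_of_comp_eq_unit {x : G.Obj} (e : G.src g = G.tgt h)
    (hu : G.comp g h = G.unit x) : G.inv g = h := by
  have hx : G.tgt g = x := by rw [← tgt_comp e, hu, G.tgt_unit]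
  rw [← inv_comp_cancel e, hu, comp_unit ((G.src_inv g).trans hx)]

theorem eq_unit_of_comp_self (e : G.src g = G.tgt g) (hg : G.comp g g = g) :
    g = G.unit (G.src g) := by
  conv_lhs => rw [← inv_comp_cancel e, hg, inv_comp]

theorem inv_unit (x : G.Obj) : G.inv (G.unit x) = G.unit x :=
  inv_eq_of_comp_eq_unit (x := x) ((G.src_unit x).trans (G.tgt_unit x).symm)
    (unit_comp (G.tgt_unit x))

theorem Hom.map_comp (F : Hom H G) {g h : H.Arr} (e : H.src g = H.tgt h) :
    F.arr (H.comp g h) = G.comp (F.arr g) (F.arr h) := by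
  rw [comp_eq_mul e, F.map_mul, comp_eq_mul]

theorem Hom.map_unit (F : Hom H G) (x : H.Obj) : F.arr (H.unit x) = G.unit (F.obj x) := by
  have hs : G.src (F.arr (H.unit x)) = F.obj x := by rw [F.src_arr, H.src_unit]
  have ht : G.tgt (F.arr (H.unit x)) = F.obj x := by rw [F.tgt_arr, H.tgt_unit]
  have h := eq_unit_of_comp_self (hs.trans ht.symm) (by
    rw [← F.map_comp ((H.src_unit x).trans (H.tgt_unit x).symm), unit_comp (H.tgt_unit x)])
  rw [h, hs]

theorem Hom.map_inv (F : Hom H G) (g : H.Arr) : F.arr (H.inv g) = G.inv (F.arr g) := by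
  refine (inv_eq_of_comp_eq_unit (x := F.obj (H.tgt g)) ?_ ?_).symm
  · rw [F.src_arr, F.tgt_arr, H.tgt_inv]
  · rw [← F.map_comp (H.tgt_inv g).symm, comp_inv, F.map_unit]

/-- The conjugate `b⁻¹ g a` of the arrow `g` by arrows `a` and `b` into its source and target. -/
noncomputable def conj (G : LieGroupoid.{u}) (b g a : G.Arr) : G.Arr :=
  G.comp (G.inv b) (G.comp g a)

variable {a b c : G.Arr}

theorem src_conj (ea : G.src g = G.tgt a) (eb : G.tgt b = G.tgt g) :
    G.src (G.conj b g a) = G.src a := by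
  rw [conj, src_comp (by rw [G.src_inv, tgt_comp ea, eb]), src_comp ea]

theorem tgt_conj (ea : G.src g = G.tgt a) (eb : G.tgt b = G.tgt g) :
    G.tgt (G.conj b g a) = G.src b := by
  rw [conj, tgt_comp (by rw [G.src_inv, tgt_comp ea, eb]), G.tgt_inv]

theorem Hom.map_conj (F : Hom H G) {a b g : H.Arr} (ea : H.src g = H.tgt a)
    (eb : H.tgt b = H.tgt g) :
    F.arr (H.conj b g a) = G.conj (F.arr b) (F.arr g) (F.arr a) := by
  rw [conj, F.map_comp (by rw [H.src_inv, tgt_comp ea, eb]), F.map_comp ea, F.map_inv, conj]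

theorem conj_comp_conj (ea : G.src h = G.tgt a) (eb : G.tgt b = G.tgt h)
    (eb' : G.src g = G.tgt b) (ec : G.tgt c = G.tgt g) :
    G.comp (G.conj c g b) (G.conj b h a) = G.conj c (G.comp g h) a := by
  have e1 : G.src (G.inv c) = G.tgt (G.comp g b) := by rw [G.src_inv, tgt_comp eb', ec]
  have e2 : G.src (G.inv b) = G.tgt (G.comp h a) := by rw [G.src_inv, tgt_comp ea, eb]
  have e3 : G.src b = G.tgt (G.comp (G.inv b) (G.comp h a)) := by rw [tgt_comp e2, G.tgt_inv]
  rw [conj, conj, conj, comp_assoc e1 ((src_comp eb').trans e3), comp_assoc eb' e3,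
    comp_inv_cancel (by rw [eb, tgt_comp ea]), comp_assoc (eb'.trans eb) ea]

theorem conj_unit {x y : G.Obj} (hx : G.src g = x) (hy : G.tgt g = y) :
    G.conj (G.unit y) g (G.unit x) = g := by
  rw [conj, comp_unit hx, inv_unit, unit_comp hy]

end Comp

section Nerve

variable {n : ℕ}

/-- The composite arrow `x₀ → xⱼ` of the first `j` arrows of a string. -/
noncomputable def path (p : G.nerve n) (j : Fin (n + 1)) : G.Arr :=
  Fin.induction (motive := fun _ => G.Arr) (G.unit (p.1.1 0)) (fun i k => G.comp (p.1.2 i) k) j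

theorem path_zero (p : G.nerve n) : path p 0 = G.unit (p.1.1 0) := rfl

theorem path_succ (p : G.nerve n) (j : Fin n) :
    path p j.succ = G.comp (p.1.2 j) (path p j.castSucc) := rfl

theorem src_tgt_path (p : G.nerve n) (j : Fin (n + 1)) :
    G.src (path p j) = p.1.1 0 ∧ G.tgt (path p j) = p.1.1 j := by
  induction j using Fin.induction with
  | zero => exact ⟨G.src_unit _, G.tgt_unit _⟩
  | succ j ih =>
    have e : G.src (p.1.2 j) = G.tgt (path p j.castSucc) := (p.2 j).1.trans ih.2.symm
    exact ⟨(src_comp e).trans ih.1, (tgt_comp e).trans (p.2 j).2⟩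

/-- The arrow `xⱼ → xₖ` between two vertices of a string. -/
noncomputable def edge (p : G.nerve n) (j k : Fin (n + 1)) : G.Arr :=
  G.comp (path p k) (G.inv (path p j))

theorem path_inv_composable (p : G.nerve n) (j k : Fin (n + 1)) :
    G.src (path p k) = G.tgt (G.inv (path p j)) := by
  rw [G.tgt_inv, (src_tgt_path p k).1, (src_tgt_path p j).1]

theorem src_edge (p : G.nerve n) (j k : Fin (n + 1)) : G.src (edge p j k) = p.1.1 j := by
  rw [edge, src_comp (path_inv_composable p j k), G.src_inv, (src_tgt_path p j).2]

theorem tgt_edge (p : G.nerve n) (j k : Fin (n + 1)) : G.tgt (edge p j k) = p.1.1 k := by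
  rw [edge, tgt_comp (path_inv_composable p j k), (src_tgt_path p k).2]

theorem edge_composable (p : G.nerve n) (j k l : Fin (n + 1)) :
    G.src (edge p k l) = G.tgt (edge p j k) := by
  rw [src_edge, tgt_edge]

theorem edge_comp_edge (p : G.nerve n) (j k l : Fin (n + 1)) :
    G.comp (edge p k l) (edge p j k) = edge p j l := by
  have e := path_inv_composable p
  rw [edge, edge, edge, comp_assoc (e k l) (by rw [G.src_inv, tgt_comp (e j k)]),
    inv_comp_cancel (e j k)]

theorem edge_castSucc_succ (p : G.nerve n) (j : Fin n) : edge p j.castSucc j.succ = p.1.2 j := by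
  have e : G.src (p.1.2 j) = G.tgt (path p j.castSucc) :=
    (p.2 j).1.trans (src_tgt_path p _).2.symm
  rw [edge, path_succ, comp_assoc e (G.tgt_inv _).symm, comp_inv, comp_unit e]

theorem edge_eq_of_functorial (p : G.nerve n) (t : Fin (n + 1) → Fin (n + 1) → G.Arr)
    (hs : ∀ j k, G.src (t j k) = p.1.1 j) (ht : ∀ j k, G.tgt (t j k) = p.1.1 k)
    (hc : ∀ j k l, G.comp (t k l) (t j k) = t j l)
    (hp : ∀ j : Fin n, t j.castSucc j.succ = p.1.2 j) (j k : Fin (n + 1)) :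
    edge p j k = t j k := by
  have h0 : ∀ j, t j j = G.unit (p.1.1 j) := fun j => by
    rw [eq_unit_of_comp_self ((hs j j).trans (ht j j).symm) (hc j j j), hs]
  have hpath : ∀ j, path p j = t 0 j := by
    intro j
    induction j using Fin.induction with
    | zero => rw [path_zero, h0]
    | succ j ih => rw [path_succ, ih, ← hp, hc]
  have hinv : G.inv (t 0 j) = t j 0 :=
    inv_eq_of_comp_eq_unit ((hs _ _).trans (ht _ _).symm) ((hc j 0 j).trans (h0 j))
  rw [edge, hpath, hpath, hinv, hc]

theorem faceArr_eq_edge (i : Fin (n + 2)) (p : G.nerve (n + 1)) (j : Fin n) :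
    faceArr i p j = edge p (i.succAbove j.castSucc) (i.succAbove j.succ) := by
  have e1 : (j : ℕ) + 1 ≤ i → i.succAbove j.castSucc = j.castSucc.castSucc := fun h =>
    Fin.succAbove_of_castSucc_lt _ _ (by simp [Fin.lt_def]; omega)
  have e2 : ¬ (j : ℕ) + 1 ≤ i → i.succAbove j.castSucc = j.succ.castSucc := fun h =>
    Fin.succAbove_of_le_castSucc _ _ (by simp [Fin.le_def]; omega)
  have e3 : (j : ℕ) + 1 < i → i.succAbove j.succ = j.castSucc.succ := fun h =>
    Fin.succAbove_of_castSucc_lt _ _ (by simpa [Fin.lt_def] using h)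
  have e4 : ¬ (j : ℕ) + 1 < i → i.succAbove j.succ = j.succ.succ := fun h =>
    Fin.succAbove_of_le_castSucc _ _ (by simpa [Fin.le_def] using h)
  rw [faceArr]
  split_ifs with ha hb
  · rw [e1 ha.le, e3 ha, edge_castSucc_succ]
  · rw [e1 hb.le, e4 ha, ← comp_eq_mul, ← edge_castSucc_succ p j.succ,
      ← edge_castSucc_succ p j.castSucc]
    exact edge_comp_edge _ _ _ _
  · rw [e2 (by omega), e4 ha, edge_castSucc_succ]

theorem edge_face (i : Fin (n + 2)) (p : G.nerve (n + 1)) (j k : Fin (n + 1)) :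
    edge (face i p) j k = edge p (i.succAbove j) (i.succAbove k) := by
  refine edge_eq_of_functorial (face i p) (fun j k => edge p (i.succAbove j) (i.succAbove k))
    ?_ ?_ ?_ ?_ j k
  · exact fun j k => src_edge _ _ _
  · exact fun j k => tgt_edge _ _ _
  · exact fun j k l => edge_comp_edge _ _ _ _
  · exact fun j => (faceArr_eq_edge i p j).symm

end Nerve

section SmoothArrows

variable {E : Type*} [NormedAddCommGroup E] [NormedSpace ℝ E] {X : Type*} [TopologicalSpace X]
  {M : Type*} [TopologicalSpace M] [ChartedSpace X M] {I : ModelWithCorners ℝ E X} {S : Set M}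

theorem smooth_comp {g h : S → G.Arr} (hg : SmoothOnSubset I (𝓡 G.dimArr) S g)
    (hh : SmoothOnSubset I (𝓡 G.dimArr) S h) (e : ∀ x, G.src (g x) = G.tgt (h x)) :
    SmoothOnSubset I (𝓡 G.dimArr) S (fun x => G.comp (g x) (h x)) := by
  simp only [comp_eq_mul (e _)]
  exact G.smooth_mul.comp (g := fun x => ⟨(g x, h x), e x⟩) (hg.prodMk hh)

theorem smooth_conj {a b g : S → G.Arr} (hb : SmoothOnSubset I (𝓡 G.dimArr) S b)
    (hg : SmoothOnSubset I (𝓡 G.dimArr) S g) (ha : SmoothOnSubset I (𝓡 G.dimArr) S a)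
    (ea : ∀ x, G.src (g x) = G.tgt (a x)) (eb : ∀ x, G.tgt (b x) = G.tgt (g x)) :
    SmoothOnSubset I (𝓡 G.dimArr) S (fun x => G.conj (b x) (g x) (a x)) :=
  smooth_comp (hb.contMDiff_comp G.smooth_inv) (smooth_comp hg ha ea) fun x => by
    rw [G.src_inv, tgt_comp (ea x), eb]

end SmoothArrows

section SmoothNerve

variable {n : ℕ}

theorem smooth_vertex (j : Fin (n + 1)) : SmoothOnSubset (G.nerveModel n) (𝓡 G.dimObj)
    (G.nerve n) (fun p => p.1.1 j) :=
  SmoothOnSubset.of_contMDiff ((contMDiff_eval_manifold j).comp contMDiff_fst)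

theorem smooth_path (j : Fin (n + 1)) : SmoothOnSubset (G.nerveModel n) (𝓡 G.dimArr)
    (G.nerve n) (fun p => path p j) := by
  induction j using Fin.induction with
  | zero =>
    change SmoothOnSubset _ _ _ fun p : G.nerve n => G.unit (p.1.1 0)
    exact (smooth_vertex 0).contMDiff_comp G.smooth_unit
  | succ j ih =>
    change SmoothOnSubset _ _ _ fun p : G.nerve n => G.comp (p.1.2 j) (path p j.castSucc)
    exact smooth_comp
      (SmoothOnSubset.of_contMDiff ((contMDiff_eval_manifold j).comp contMDiff_snd)) ih
      fun p => (p.2 j).1.trans (src_tgt_path p _).2.symm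

theorem smooth_edge (j k : Fin (n + 1)) : SmoothOnSubset (G.nerveModel n) (𝓡 G.dimArr)
    (G.nerve n) (fun p => edge p j k) :=
  smooth_comp (smooth_path k) ((smooth_path j).contMDiff_comp G.smooth_inv)
    fun p => path_inv_composable p j k

end SmoothNerve

end LieGroupoid

/-! ### Labelled functors -/

namespace LieGroupoid

variable {G H : LieGroupoid.{u}}

/-- A functor to `H` from the groupoid whose objects are the objects of `G` with a label in `B`, and
whose arrows are those of `G` between the underlying objects; `arr a b` maps the arrows from objects
with label `a` to objects with label `b`. It is smooth on the objects that lie in the domain of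
their label; its values elsewhere are junk, but still functorial. -/
structure LabelledFunctor (G H : LieGroupoid.{u}) (B : Type*) where
  obj : B → G.Obj → H.Obj
  arr : B → B → G.Arr → H.Arr
  dom : B → Set G.Obj
  src_arr : ∀ a b g, H.src (arr a b g) = obj a (G.src g)
  tgt_arr : ∀ a b g, H.tgt (arr a b g) = obj b (G.tgt g)
  map_comp : ∀ a b c g h, G.src g = G.tgt h →
    arr a c (G.comp g h) = H.comp (arr b c g) (arr a b h)
  isOpen_dom : ∀ a, IsOpen (dom a)
  smooth_obj : ∀ a, SmoothOnSubset (𝓡 G.dimObj) (𝓡 H.dimObj) (dom a) (fun x => obj a x)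
  smooth_arr : ∀ a b, SmoothOnSubset (𝓡 G.dimArr) (𝓡 H.dimArr)
    {g | G.src g ∈ dom a ∧ G.tgt g ∈ dom b} (fun g => arr a b g)

namespace LabelledFunctor

variable {B : Type*} (L : LabelledFunctor G H B) {n m : ℕ}

/-- The image under a labelled functor of the string `x_{j₀} → ⋯ → x_{jₘ}` with labels
`b₀, …, bₘ`, where `xⱼ` are the vertices of a given string and `u i = (jᵢ, bᵢ)`. -/
noncomputable def nerveMap (p : G.nerve n) (u : Fin (m + 1) → Fin (n + 1) × B) : H.nerve m :=
  ⟨(fun j => L.obj (u j).2 (p.1.1 (u j).1), fun j => L.arr (u j.castSucc).2 (u j.succ).2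
    (edge p (u j.castSucc).1 (u j.succ).1)), fun j => by
      rw [L.src_arr, L.tgt_arr, src_edge, tgt_edge]
      exact ⟨rfl, rfl⟩⟩

theorem edge_nerveMap (p : G.nerve n) (u : Fin (m + 1) → Fin (n + 1) × B) (j k : Fin (m + 1)) :
    edge (L.nerveMap p u) j k = L.arr (u j).2 (u k).2 (edge p (u j).1 (u k).1) := by
  refine edge_eq_of_functorial (L.nerveMap p u)
    (fun j k => L.arr (u j).2 (u k).2 (edge p (u j).1 (u k).1)) ?_ ?_ ?_ (fun j => rfl) j k
  · exact fun j k => (L.src_arr _ _ _).trans (congrArg _ (src_edge _ _ _))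
  · exact fun j k => (L.tgt_arr _ _ _).trans (congrArg _ (tgt_edge _ _ _))
  · intro j k l
    rw [← L.map_comp _ _ _ _ _ (edge_composable _ _ _ _), edge_comp_edge]

theorem face_nerveMap (p : G.nerve n) (u : Fin (m + 2) → Fin (n + 1) × B) (i : Fin (m + 2)) :
    face i (L.nerveMap p u) = L.nerveMap p (u ∘ i.succAbove) :=
  nerve_ext (fun _ => rfl) fun j =>
    (faceArr_eq_edge i (L.nerveMap p u) j).trans (L.edge_nerveMap p u _ _)

theorem nerveMap_face (p : G.nerve (n + 1)) (i : Fin (n + 2)) (u : Fin (m + 1) → Fin (n + 1) × B) :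
    L.nerveMap (face i p) u = L.nerveMap p (Prod.map i.succAbove id ∘ u) :=
  nerve_ext (fun _ => rfl) fun _ => congrArg (L.arr _ _) (edge_face i p _ _)

/-- The image of a string under a labelled functor, for a choice of labels for the vertices. -/
noncomputable def mapString (p : G.nerve n) (b : Fin (n + 1) → B) : H.nerve n :=
  L.nerveMap p fun j => (j, b j)

theorem mapString_arr (p : G.nerve n) (b : Fin (n + 1) → B) (j : Fin n) :
    (L.mapString p b).1.2 j = L.arr (b j.castSucc) (b j.succ) (p.1.2 j) :=
  congrArg _ (edge_castSucc_succ p j)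

theorem face_mapString (p : G.nerve (n + 1)) (b : Fin (n + 2) → B) (i : Fin (n + 2)) :
    face i (L.mapString p b) = L.mapString (face i p) (b ∘ i.succAbove) := by
  rw [mapString, mapString, face_nerveMap, nerveMap_face]
  rfl

theorem smooth_nerveMap (u : Fin (m + 1) → Fin (n + 1) × B) {T : Set (G.NerveAmbient n)}
    (hT : T ⊆ G.nerve n) (hu : ∀ p ∈ T, ∀ j, p.1 (u j).1 ∈ L.dom (u j).2) :
    SmoothOnSubset (G.nerveModel n) (H.nerveModel m) T
      (fun p => (L.nerveMap ⟨p, hT p.2⟩ u : H.NerveAmbient m)) := by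
  refine SmoothOnSubset.prodMk (SmoothOnSubset.pi fun j => ?_) (SmoothOnSubset.pi fun j => ?_)
  · exact (L.smooth_obj (u j).2).comp (g := fun p : T => ⟨p.1.1 (u j).1, hu p p.2 j⟩)
      ((smooth_vertex (u j).1).restrict hT)
  · have hdom (p : T) : edge ⟨p, hT p.2⟩ (u j.castSucc).1 (u j.succ).1 ∈
        {g | G.src g ∈ L.dom (u j.castSucc).2 ∧ G.tgt g ∈ L.dom (u j.succ).2} := by
      rw [mem_ofPred_eq, src_edge, tgt_edge]
      exact ⟨hu p p.2 _, hu p p.2 _⟩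
    exact (L.smooth_arr (u j.castSucc).2 (u j.succ).2).comp (g := fun p : T => ⟨_, hdom p⟩)
      ((smooth_edge _ _).restrict hT)

theorem smooth_cochain_nerveMap (u : Fin (m + 1) → Fin (n + 1) × B) {T : Set (G.NerveAmbient n)}
    (hT : T ⊆ G.nerve n) (hu : ∀ p ∈ T, ∀ j, p.1 (u j).1 ∈ L.dom (u j).2) (c : H.Cochain m) :
    SmoothOnSubset (G.nerveModel n) 𝓘(ℝ, ℝ) T (fun p => c.1 (L.nerveMap ⟨p, hT p.2⟩ u)) :=
  SmoothOnSubset.comp (g := fun p : T => L.nerveMap ⟨p, hT p.2⟩ u) c.2 (L.smooth_nerveMap u hT hu)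

end LabelledFunctor

end LieGroupoid

/-! ### Cochain maps and homotopies from averages -/

section Homotopy

variable {V : Type*} [Category V] [Preadditive V] {P Q : CochainComplex V ℕ} {f g : P ⟶ Q}

/-- The homotopy of maps of cochain complexes with the given components `Pⁿ⁺¹ ⟶ Qⁿ`. -/
def homotopyOfComponents (k : ∀ n, P.X (n + 1) ⟶ Q.X n)
    (comm_zero : f.f 0 = P.d 0 1 ≫ k 0 + g.f 0)
    (comm_succ : ∀ n, f.f (n + 1) =
      P.d (n + 1) (n + 2) ≫ k (n + 1) + k n ≫ Q.d n (n + 1) + g.f (n + 1)) :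
    Homotopy f g where
  hom i j := if h : j + 1 = i then eqToHom (congrArg P.X h.symm) ≫ k j else 0
  zero i j h := dif_neg h
  comm n := by
    rw [Homotopy.dNext_cochainComplex, dif_pos rfl, eqToHom_refl, Category.id_comp]
    cases n with
    | zero => rw [Homotopy.prevD_zero_cochainComplex, add_zero, comm_zero]
    | succ n =>
      rw [Homotopy.prevD_succ_cochainComplex, dif_pos rfl, eqToHom_refl, Category.id_comp,
        comm_succ]

end Homotopy

namespace LieGroupoid

variable {G H : LieGroupoid.{u}}

theorem cochainComplex_d (n : ℕ) :
    G.cochainComplex.d n (n + 1) = ModuleCat.ofHom (G.differential n) :=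
  CochainComplex.of_d (fun n => ModuleCat.of ℝ (G.Cochain n))
    (fun n => ModuleCat.ofHom (G.differential n)) n

/-- The map of cochain complexes given by linear maps that commute with the differentials. -/
noncomputable def cochainMap (f : ∀ n, H.Cochain n →ₗ[ℝ] G.Cochain n)
    (hf : ∀ n c, G.differential n (f n c) = f (n + 1) (H.differential n c)) :
    H.cochainComplex ⟶ G.cochainComplex :=
  CochainComplex.ofHom (X := H.cochainComplex) (Y := G.cochainComplex)
    (fun n => ModuleCat.ofHom (f n)) fun n => by
      rw [cochainComplex_d, cochainComplex_d]
      exact ModuleCat.hom_ext (LinearMap.ext fun c => hf n c)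

theorem cochainMap_comp_cochainMap {K : LieGroupoid.{u}} {f : ∀ n, K.Cochain n →ₗ[ℝ] H.Cochain n}
    {g : ∀ n, H.Cochain n →ₗ[ℝ] G.Cochain n} {k : ∀ n, K.Cochain n →ₗ[ℝ] G.Cochain n}
    (hf : ∀ n c, H.differential n (f n c) = f (n + 1) (K.differential n c))
    (hg : ∀ n c, G.differential n (g n c) = g (n + 1) (H.differential n c))
    (hk : ∀ n c, G.differential n (k n c) = k (n + 1) (K.differential n c))
    (hcomp : ∀ n c, g n (f n c) = k n c) :
    cochainMap f hf ≫ cochainMap g hg = cochainMap k hk :=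
  HomologicalComplex.hom_ext _ _ fun n => ModuleCat.hom_ext (LinearMap.ext fun c => hcomp n c)

theorem cochainMap_eq_id {f : ∀ n, G.Cochain n →ₗ[ℝ] G.Cochain n}
    (hf : ∀ n c, G.differential n (f n c) = f (n + 1) (G.differential n c))
    (hid : ∀ n c, f n c = c) : cochainMap f hf = 𝟙 G.cochainComplex :=
  HomologicalComplex.hom_ext _ _ fun n => ModuleCat.hom_ext (LinearMap.ext fun c => hid n c)

/-- The homotopy between maps of cochain complexes given by linear maps that lower the degree. -/
noncomputable def cochainHomotopy {f g : ∀ n, H.Cochain n →ₗ[ℝ] G.Cochain n}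
    (hf : ∀ n c, G.differential n (f n c) = f (n + 1) (H.differential n c))
    (hg : ∀ n c, G.differential n (g n c) = g (n + 1) (H.differential n c))
    (k : ∀ n, H.Cochain (n + 1) →ₗ[ℝ] G.Cochain n)
    (hk_zero : ∀ c, k 0 (H.differential 0 c) = f 0 c - g 0 c)
    (hk_succ : ∀ n c, k (n + 1) (H.differential (n + 1) c) + G.differential n (k n c) =
      f (n + 1) c - g (n + 1) c) :
    Homotopy (cochainMap f hf) (cochainMap g hg) :=
  homotopyOfComponents (fun n => ModuleCat.ofHom (k n))
    (by
      rw [cochainComplex_d]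
      exact ModuleCat.hom_ext (LinearMap.ext fun c => eq_add_of_sub_eq (hk_zero c).symm))
    fun n => by
      rw [cochainComplex_d, cochainComplex_d]
      exact ModuleCat.hom_ext (LinearMap.ext fun c => eq_add_of_sub_eq (hk_succ n c).symm)

section Average

variable {ι B : Type*} {n : ℕ} (ρ : SmoothPartitionOfUnity ι (𝓡 G.dimObj) G.Obj univ)

/-- The weights which a partition of unity assigns to the labels of the vertices of a string. -/
noncomputable def vertexWeights (p : G.nerve n) (j : Fin (n + 1)) : ι →₀ ℝ :=
  partitionWeights ρ (p.1.1 j)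

theorem sum_vertexWeights (p : G.nerve n) (j : Fin (n + 1)) :
    (vertexWeights ρ p j).sum (fun _ w => w) = 1 :=
  sum_partitionWeights ρ (mem_univ _)

theorem sum_labelAverage_face (p : G.nerve (n + 1)) (φ : Fin (n + 2) → (Fin (n + 1) → ι) → ℝ) :
    ∑ i : Fin (n + 2), (-1 : ℝ) ^ (i : ℕ) * labelAverage (vertexWeights ρ (face i p)) (φ i) =
      labelAverage (vertexWeights ρ p)
        (fun a => ∑ i : Fin (n + 2), (-1 : ℝ) ^ (i : ℕ) * φ i (a ∘ i.succAbove)) := by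
  have hsum : (fun a : Fin (n + 2) → ι =>
      ∑ i : Fin (n + 2), (-1 : ℝ) ^ (i : ℕ) * φ i (a ∘ i.succAbove)) =
      ∑ i : Fin (n + 2), (-1 : ℝ) ^ (i : ℕ) • fun a : Fin (n + 2) → ι => φ i (a ∘ i.succAbove) := by
    ext a
    simp
  rw [hsum, map_sum]
  refine Finset.sum_congr rfl fun i _ => ?_
  rw [map_smul, labelAverage_comp_succAbove i (sum_vertexWeights ρ p i)]
  rfl

namespace LabelledFunctor

variable (L : LabelledFunctor G H B) (l k : ι → B) (hl : ρ.IsSubordinate fun i => L.dom (l i))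
  (hk : ρ.IsSubordinate fun i => L.dom (k i))

/-- Pullback of cochains along a labelled functor, averaged over the labels of the vertices with the
weights of a partition of unity. -/
noncomputable def averagePullback (n : ℕ) : H.Cochain n →ₗ[ℝ] G.Cochain n where
  toFun c := ⟨fun p => labelAverage (vertexWeights ρ p) fun a => c.1 (L.mapString p (l ∘ a)),
    smooth_labelAverage ρ (fun _ => L.isOpen_dom _) hl
      (fun j => (contMDiff_eval_manifold j).comp contMDiff_fst) fun a =>
        L.smooth_cochain_nerveMap (fun j => (j, l (a j))) inter_subset_left (fun _ hp => hp.2) c⟩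
  map_add' _ _ := Subtype.ext (funext fun p => map_add (labelAverage (vertexWeights ρ p)) _ _)
  map_smul' _ _ := Subtype.ext (funext fun p => map_smul (labelAverage (vertexWeights ρ p)) _ _)

theorem differential_averagePullback (n : ℕ) (c : H.Cochain n) :
    G.differential n (L.averagePullback ρ l hl n c) =
      L.averagePullback ρ l hl (n + 1) (H.differential n c) := by
  refine Subtype.ext (funext fun p => ?_)
  rw [differential_apply]
  refine (sum_labelAverage_face ρ p fun i a => c.1 (L.mapString (face i p) (l ∘ a))).trans ?_
  refine congrArg _ (funext fun a => ?_)
  simp only [differential_apply, face_mapString, Function.comp_assoc]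

/-- The map of cochain complexes given by averaged pullback along a labelled functor. -/
noncomputable def averageMap : H.cochainComplex ⟶ G.cochainComplex :=
  cochainMap (L.averagePullback ρ l hl) (L.differential_averagePullback ρ l hl)

/-- The vertices `0, …, n` of a string, each with two labels. -/
def labelledVertices (a : Fin (n + 1) → ι) (j : Fin (n + 1)) :
    (Fin (n + 1) × B) × (Fin (n + 1) × B) :=
  ((j, l (a j)), (j, k (a j)))

theorem prismTuple_labelledVertices_mem_dom {a : Fin (n + 1) → ι}
    {x : Fin (n + 1) → G.Obj} (hx : ∀ j, x j ∈ L.dom (l (a j)) ∩ L.dom (k (a j)))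
    (i : Fin (n + 1)) (j : Fin (n + 2)) :
    x (prismTuple (labelledVertices l k a) i j).1 ∈
      L.dom (prismTuple (labelledVertices l k a) i j).2 := by
  rw [prismTuple]
  split_ifs
  · exact (hx _).1
  · exact (hx _).2

/-- The prism operator between two labellings of the vertices, averaged over the labels. -/
noncomputable def averagePrism (n : ℕ) : H.Cochain (n + 1) →ₗ[ℝ] G.Cochain n where
  toFun c := ⟨fun p => labelAverage (vertexWeights ρ p) fun a =>
      tuplePrism ℝ (labelledVertices l k a) fun u => c.1 (L.nerveMap p u),
    smooth_labelAverage ρ (fun i => (L.isOpen_dom (l i)).inter (L.isOpen_dom (k i)))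
      (fun i => subset_inter (hl i) (hk i))
      (fun j => (contMDiff_eval_manifold j).comp contMDiff_fst) fun a => by
        simp only [tuplePrism_apply, smul_eq_mul]
        exact SmoothOnSubset.sum (fun i => SmoothOnSubset.const_mul _ <|
          L.smooth_cochain_nerveMap (prismTuple (labelledVertices l k a) i) inter_subset_left
            (fun _ hp => L.prismTuple_labelledVertices_mem_dom l k hp.2 i) c) _⟩
  map_add' c c' := by
    refine Subtype.ext (funext fun p => ?_)
    simp only [Submodule.coe_add, Pi.add_apply, ← Pi.add_def, map_add]
  map_smul' r c := by
    refine Subtype.ext (funext fun p => ?_)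
    simp only [Submodule.coe_smul, Pi.smul_apply, ← Pi.smul_def, map_smul]
    rfl

theorem averagePrism_differential_apply (c : H.Cochain n) (p : G.nerve n) :
    (L.averagePrism ρ l k hl hk n (H.differential n c)).1 p =
      labelAverage (vertexWeights ρ p) fun a => tuplePrism ℝ (labelledVertices l k a) fun u =>
        tupleDifferential ℝ u fun v => c.1 (L.nerveMap p v) := by
  simp only [tupleDifferential_apply, smul_eq_mul, ← face_nerveMap, ← differential_apply]
  rfl

theorem differential_averagePrism_apply (c : H.Cochain (n + 1)) (p : G.nerve (n + 1)) :
    (G.differential n (L.averagePrism ρ l k hl hk n c)).1 p =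
      labelAverage (vertexWeights ρ p) fun a =>
        tupleDifferential ℝ (labelledVertices l k a) fun z =>
          tuplePrism ℝ z fun u => c.1 (L.nerveMap p u) := by
  rw [differential_apply]
  refine (sum_labelAverage_face ρ p fun i a => tuplePrism ℝ (labelledVertices l k a) fun u =>
    c.1 (L.nerveMap (face i p) u)).trans ?_
  refine congrArg _ (funext fun a => ?_)
  simp only [tupleDifferential_apply, smul_eq_mul, nerveMap_face]
  refine Finset.sum_congr rfl fun i _ => congrArg _ ?_
  exact tuplePrism_comp ℝ (Prod.map i.succAbove id) (fun u => c.1 (L.nerveMap p u)) _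

theorem labelAverage_prism_homotopy (c : H.Cochain n) (p : G.nerve n) :
    (L.averagePrism ρ l k hl hk n (H.differential n c)).1 p +
      labelAverage (vertexWeights ρ p) (fun a =>
        tupleDifferential ℝ (labelledVertices l k a) fun z =>
          tuplePrism ℝ z fun u => c.1 (L.nerveMap p u)) =
    (L.averagePullback ρ k hk n c).1 p - (L.averagePullback ρ l hl n c).1 p := by
  rw [averagePrism_differential_apply]
  refine (map_add (labelAverage (vertexWeights ρ p)) _ _).symm.trans ?_
  refine Eq.trans ?_ (map_sub (labelAverage (vertexWeights ρ p)) _ _)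
  exact congrArg _ (funext fun a =>
    tuplePrism_homotopy ℝ (fun u => c.1 (L.nerveMap p u)) (labelledVertices l k a))

/-- The homotopy between the averaged pullbacks for two ways of labelling. -/
noncomputable def averageHomotopy :
    Homotopy (L.averageMap ρ k hk) (L.averageMap ρ l hl) :=
  cochainHomotopy _ _ (L.averagePrism ρ l k hl hk)
    (fun c => Subtype.ext <| funext fun p => by
      refine (left_eq_add.2 ?_).trans (L.labelAverage_prism_homotopy ρ l k hl hk c p)
      simp only [tuplePrism_apply, Finset.univ_eq_empty, Finset.sum_empty, ← Pi.zero_def, map_zero])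
    fun n c => Subtype.ext <| funext fun p => by
      refine Eq.trans ?_ (L.labelAverage_prism_homotopy ρ l k hl hk c p)
      rw [← differential_averagePrism_apply]
      rfl

theorem averagePullback_apply_of_forall_eq (c : H.Cochain n) (p : G.nerve n) {q : H.nerve n}
    (hq : ∀ a : Fin (n + 1) → ι, L.mapString p (l ∘ a) = q) :
    (L.averagePullback ρ l hl n c).1 p = c.1 q := by
  refine Eq.trans ?_ (labelAverage_const (sum_vertexWeights ρ p) (c.1 q))
  exact congrArg _ (funext fun a => congrArg c.1 (hq a))

end LabelledFunctor

end Average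

end LieGroupoid

/-! ### Pullback along homomorphisms and local quasi-inverses -/

namespace LieGroupoid

variable {G H : LieGroupoid.{u}} {ι : Type*}

namespace Hom

variable (F : Hom H G) {n : ℕ}

/-- The map of nerves induced by a homomorphism. -/
def mapNerve (p : H.nerve n) : G.nerve n :=
  ⟨(fun j => F.obj (p.1.1 j), fun j => F.arr (p.1.2 j)), fun j => by
    rw [F.src_arr, F.tgt_arr, (p.2 j).1, (p.2 j).2]
    exact ⟨rfl, rfl⟩⟩

theorem face_mapNerve (i : Fin (n + 2)) (p : H.nerve (n + 1)) :
    face i (F.mapNerve p) = F.mapNerve (face i p) := by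
  refine nerve_ext (fun _ => rfl) fun j => ?_
  change faceArr i (F.mapNerve p) j = F.arr (faceArr i p j)
  simp only [faceArr]
  split_ifs
  · rfl
  · exact (F.map_mul ⟨(p.1.2 j.succ, p.1.2 j.castSucc), nerve_composable p j⟩).symm
  · rfl

theorem smooth_mapNerve : SmoothOnSubset (H.nerveModel n) (G.nerveModel n) (H.nerve n)
    (fun p => (F.mapNerve p : G.NerveAmbient n)) :=
  SmoothOnSubset.prodMk
    (SmoothOnSubset.pi fun j => (smooth_vertex j).contMDiff_comp F.smooth_obj)
    (SmoothOnSubset.pi fun j => SmoothOnSubset.of_contMDiff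
      (F.smooth_arr.comp ((contMDiff_eval_manifold j).comp contMDiff_snd)))

/-- The pullback of cochains along a homomorphism. -/
def pullbackCochain (n : ℕ) : G.Cochain n →ₗ[ℝ] H.Cochain n where
  toFun c := ⟨fun p => c.1 (F.mapNerve p), c.2.comp F.smooth_mapNerve⟩
  map_add' _ _ := rfl
  map_smul' _ _ := rfl

theorem differential_pullbackCochain (n : ℕ) (c : G.Cochain n) :
    H.differential n (F.pullbackCochain n c) = F.pullbackCochain (n + 1) (G.differential n c) := by
  refine Subtype.ext (funext fun p => ?_)
  refine (differential_apply n _ p).trans (Eq.trans ?_ (differential_apply n c _).symm)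
  simp only [face_mapNerve]
  rfl

/-- The map of cochain complexes induced by a homomorphism. -/
noncomputable def pullbackMap : G.cochainComplex ⟶ H.cochainComplex :=
  cochainMap F.pullbackCochain F.differential_pullbackCochain

end Hom

/-- A family of sections `y ↦ (arrow i y : _ → y)` of the target map, each smooth on an open set
`dom i` only. -/
structure TargetSections (G : LieGroupoid.{u}) (ι : Type*) where
  arrow : ι → G.Obj → G.Arr
  dom : ι → Set G.Obj
  tgt_arrow : ∀ i y, G.tgt (arrow i y) = y
  isOpen_dom : ∀ i, IsOpen (dom i)
  smooth_arrow : ∀ i, ContMDiffOn (𝓡 G.dimObj) (𝓡 G.dimArr) ∞ (arrow i) (dom i)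

namespace TargetSections

variable (T : TargetSections G ι)

theorem src_conj_arrow (a b : ι) (g : G.Arr) :
    G.src (G.conj (T.arrow b (G.tgt g)) g (T.arrow a (G.src g))) =
      G.src (T.arrow a (G.src g)) :=
  src_conj (T.tgt_arrow _ _).symm (T.tgt_arrow _ _)

theorem tgt_conj_arrow (a b : ι) (g : G.Arr) :
    G.tgt (G.conj (T.arrow b (G.tgt g)) g (T.arrow a (G.src g))) =
      G.src (T.arrow b (G.tgt g)) :=
  tgt_conj (T.tgt_arrow _ _).symm (T.tgt_arrow _ _)

theorem conj_arrow_comp (a b c : ι) {g h : G.Arr} (e : G.src g = G.tgt h) :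
    G.conj (T.arrow c (G.tgt (G.comp g h))) (G.comp g h) (T.arrow a (G.src (G.comp g h))) =
      G.comp (G.conj (T.arrow c (G.tgt g)) g (T.arrow b (G.src g)))
        (G.conj (T.arrow b (G.tgt h)) h (T.arrow a (G.src h))) := by
  rw [src_comp e, tgt_comp e, e, conj_comp_conj (T.tgt_arrow _ _).symm (T.tgt_arrow _ _)
    (e.trans (T.tgt_arrow _ _).symm) (T.tgt_arrow _ _)]

theorem smooth_conj_arrow (a b : ι) : SmoothOnSubset (𝓡 G.dimArr) (𝓡 G.dimArr)
    {g | G.src g ∈ T.dom a ∧ G.tgt g ∈ T.dom b}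
    (fun g => G.conj (T.arrow b (G.tgt g)) g (T.arrow a (G.src g))) :=
  smooth_conj
    (SmoothOnSubset.contMDiffOn_comp (T.isOpen_dom b) (T.smooth_arrow b)
      (SmoothOnSubset.of_contMDiff G.smooth_tgt) fun g => g.2.2)
    (SmoothOnSubset.of_contMDiff contMDiff_id)
    (SmoothOnSubset.contMDiffOn_comp (T.isOpen_dom a) (T.smooth_arrow a)
      (SmoothOnSubset.of_contMDiff G.smooth_src) fun g => g.2.1)
    (fun _ => (T.tgt_arrow _ _).symm) fun _ => T.tgt_arrow _ _

/-- Conjugation by sections of the target map: the arrow `g` is sent to `b⁻¹ g a`, where `a` and `b`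
are the values at its source and target of the sections that label these objects. -/
noncomputable def conjFunctor : LabelledFunctor G G ι where
  obj i y := G.src (T.arrow i y)
  arr a b g := G.conj (T.arrow b (G.tgt g)) g (T.arrow a (G.src g))
  dom := T.dom
  src_arr := T.src_conj_arrow
  tgt_arr := T.tgt_conj_arrow
  map_comp a b c _ _ := T.conj_arrow_comp a b c
  isOpen_dom := T.isOpen_dom
  smooth_obj i := SmoothOnSubset.of_contMDiffOn (T.isOpen_dom i)
    (G.smooth_src.comp_contMDiffOn (T.smooth_arrow i))
  smooth_arr := T.smooth_conj_arrow

/-- The family of sections of the target map enlarged by the units, with label `none`. -/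
def withUnits : TargetSections G (Option ι) where
  arrow b y := b.elim (G.unit y) fun i => T.arrow i y
  dom b := b.elim univ T.dom
  tgt_arrow b y := by cases b; exacts [G.tgt_unit y, T.tgt_arrow _ y]
  isOpen_dom b := by cases b; exacts [isOpen_univ, T.isOpen_dom _]
  smooth_arrow b := by cases b; exacts [G.smooth_unit.contMDiffOn, T.smooth_arrow _]

theorem mapString_withUnits_none {n : ℕ} (p : G.nerve n) :
    T.withUnits.conjFunctor.mapString p (fun _ => none) = p :=
  nerve_ext (fun _ => G.src_unit _) fun _ =>
    (T.withUnits.conjFunctor.mapString_arr _ _ _).trans (conj_unit rfl rfl)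

variable {ρ : SmoothPartitionOfUnity ι (𝓡 G.dimObj) G.Obj univ} (hρ : ρ.IsSubordinate T.dom)

theorem averageMap_withUnits_none :
    T.withUnits.conjFunctor.averageMap ρ (fun _ => none) (fun _ => subset_univ _) =
      𝟙 G.cochainComplex :=
  cochainMap_eq_id _ fun _ c => Subtype.ext <| funext fun p =>
    LabelledFunctor.averagePullback_apply_of_forall_eq _ _ _ _ c p
      fun _ => T.mapString_withUnits_none p

theorem averageMap_withUnits_some :
    T.withUnits.conjFunctor.averageMap ρ some hρ = T.conjFunctor.averageMap ρ id hρ :=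
  rfl

/-- Averaged conjugation by sections of the target map is homotopic to the identity, since the
sections and the units are part of one family. -/
noncomputable def averageConjHomotopy :
    Homotopy (T.conjFunctor.averageMap ρ id hρ) (𝟙 G.cochainComplex) :=
  ((Homotopy.ofEq (T.averageMap_withUnits_some hρ).symm).trans
    (T.withUnits.conjFunctor.averageHomotopy ρ (fun _ => none) some (fun _ => subset_univ _)
      hρ)).trans (Homotopy.ofEq T.averageMap_withUnits_none)

end TargetSections

namespace Hom

/-- The data which make the natural map from `H` to the pullback groupoid of `G` along `F : H → G` a
diffeomorphism on arrows: the arrow of `H` with given image under `F`, target and source. -/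
structure FullyFaithful (F : Hom H G) where
  preimage : G.pullbackArr F.obj → H.Arr
  leftInverse : LeftInverse preimage F.toPullback
  rightInverse : RightInverse preimage F.toPullback
  smooth_preimage :
    SmoothOnSubset ((𝓡 H.dimObj).prod ((𝓡 G.dimArr).prod (𝓡 H.dimObj))) (𝓡 H.dimArr)
      (G.pullbackArr F.obj) preimage

namespace FullyFaithful

variable {F : Hom H G} (K : F.FullyFaithful)

theorem arr_ext (K : F.FullyFaithful) {h h' : H.Arr} (ht : H.tgt h = H.tgt h')
    (ha : F.arr h = F.arr h') (hs : H.src h = H.src h') : h = h' :=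
  K.leftInverse.injective (Subtype.ext (Prod.ext ht (Prod.ext ha hs)))

theorem tgt_preimage (q : G.pullbackArr F.obj) : H.tgt (K.preimage q) = q.1.1 :=
  congrArg (fun q => q.1.1) (K.rightInverse q)

theorem arr_preimage (q : G.pullbackArr F.obj) : F.arr (K.preimage q) = q.1.2.1 :=
  congrArg (fun q => q.1.2.1) (K.rightInverse q)

theorem src_preimage (q : G.pullbackArr F.obj) : H.src (K.preimage q) = q.1.2.2 :=
  congrArg (fun q => q.1.2.2) (K.rightInverse q)

theorem preimage_comp {q q' q'' : G.pullbackArr F.obj} (e : q.1.2.2 = q'.1.1)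
    (ht : q''.1.1 = q.1.1) (ha : q''.1.2.1 = G.comp q.1.2.1 q'.1.2.1)
    (hs : q''.1.2.2 = q'.1.2.2) :
    K.preimage q'' = H.comp (K.preimage q) (K.preimage q') := by
  have he : H.src (K.preimage q) = H.tgt (K.preimage q') := by
    rw [K.src_preimage, K.tgt_preimage, e]
  refine K.arr_ext ?_ ?_ ?_
  · rw [tgt_comp he, K.tgt_preimage, K.tgt_preimage, ht]
  · rw [F.map_comp he, K.arr_preimage, K.arr_preimage, K.arr_preimage, ha]
  · rw [src_comp he, K.src_preimage, K.src_preimage, hs]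

end FullyFaithful

end Hom

/-- Local lifts of the objects of `G` along `F : H → G` up to an arrow of `G`: for each label `i`
and object `y` an object `lift i y` of `H` and an arrow `arrow i y : F (lift i y) → y`. -/
structure LocalLifts (F : Hom H G) (ι : Type*) extends TargetSections G ι where
  lift : ι → G.Obj → H.Obj
  src_arrow : ∀ i y, G.src (arrow i y) = F.obj (lift i y)
  smooth_lift : ∀ i, ContMDiffOn (𝓡 G.dimObj) (𝓡 H.dimObj) ∞ (lift i) (dom i)

theorem SmoothlyEssentiallySurjective.exists_localLifts {F : Hom H G}
    (h : G.SmoothlyEssentiallySurjective (d := H.dimObj) F.obj) :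
    ∃ s : LocalLifts F G.Obj, ∀ y, y ∈ s.dom y := by
  classical
  choose g₀ x₀ hs₀ ht₀ using h.1
  choose σ hσ using h.exists_local_section F.smooth_obj
  choose U hσU hU hyU using fun y => eventually_nhds_iff.1 (hσ y)
  have hsmooth (i : G.Obj) :
      ContMDiffOn (𝓡 G.dimObj) ((𝓡 G.dimArr).prod (𝓡 H.dimObj)) ∞ (σ i) (U i) :=
    fun y hy => (hσU i y hy).1.contMDiffWithinAt
  refine ⟨{
    arrow := fun i => (U i).piecewise (fun y => (σ i y).1) g₀
    lift := fun i => (U i).piecewise (fun y => (σ i y).2) x₀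
    dom := U
    src_arrow := fun i y => ?_
    tgt_arrow := fun i y => ?_
    isOpen_dom := hU
    smooth_arrow := fun i => (contMDiff_fst.comp_contMDiffOn (hsmooth i)).congr
      fun y hy => piecewise_eq_of_mem _ _ _ hy
    smooth_lift := fun i => (contMDiff_snd.comp_contMDiffOn (hsmooth i)).congr
      fun y hy => piecewise_eq_of_mem _ _ _ hy }, hyU⟩
  · by_cases hy : y ∈ U i
    · simp only [piecewise_eq_of_mem _ _ _ hy, (hσU i y hy).2.2]
    · simp only [piecewise_eq_of_notMem _ _ _ hy, ht₀]
  · by_cases hy : y ∈ U i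
    · simp only [piecewise_eq_of_mem _ _ _ hy, (hσU i y hy).2.1]
    · simp only [piecewise_eq_of_notMem _ _ _ hy, hs₀]

namespace LocalLifts

variable {F : Hom H G} (s : LocalLifts F ι) (K : F.FullyFaithful)

theorem conj_arrow_mem_pullbackArr (a b : ι) (g : G.Arr) :
    (s.lift b (G.tgt g), G.conj (s.arrow b (G.tgt g)) g (s.arrow a (G.src g)),
      s.lift a (G.src g)) ∈ G.pullbackArr F.obj := by
  constructor
  · rw [s.tgt_conj_arrow, s.src_arrow]
  · rw [s.src_conj_arrow, s.src_arrow]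

theorem smooth_preimage_conj_arrow (a b : ι) : SmoothOnSubset (𝓡 G.dimArr) (𝓡 H.dimArr)
    {g | G.src g ∈ s.dom a ∧ G.tgt g ∈ s.dom b}
    (fun g => K.preimage ⟨_, s.conj_arrow_mem_pullbackArr a b g⟩) :=
  K.smooth_preimage.comp
    (g := fun g : {g | G.src g ∈ s.dom a ∧ G.tgt g ∈ s.dom b} =>
      ⟨_, s.conj_arrow_mem_pullbackArr a b g⟩) <|
    (SmoothOnSubset.contMDiffOn_comp (s.isOpen_dom b) (s.smooth_lift b)
      (SmoothOnSubset.of_contMDiff G.smooth_tgt) fun g => g.2.2).prodMk <|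
    (s.smooth_conj_arrow a b).prodMk <|
    SmoothOnSubset.contMDiffOn_comp (s.isOpen_dom a) (s.smooth_lift a)
      (SmoothOnSubset.of_contMDiff G.smooth_src) fun g => g.2.1

/-- The quasi-inverse of a fully faithful homomorphism given by local lifts of the objects. -/
noncomputable def functor : LabelledFunctor G H ι where
  obj := s.lift
  arr a b g := K.preimage ⟨_, s.conj_arrow_mem_pullbackArr a b g⟩
  dom := s.dom
  src_arr _ _ _ := K.src_preimage _
  tgt_arr _ _ _ := K.tgt_preimage _
  map_comp a b c _ _ e := K.preimage_comp (congrArg (s.lift b) e)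
    (congrArg (s.lift c) (tgt_comp e)) (s.conj_arrow_comp a b c e)
    (congrArg (s.lift a) (src_comp e))
  isOpen_dom := s.isOpen_dom
  smooth_obj i := SmoothOnSubset.of_contMDiffOn (s.isOpen_dom i) (s.smooth_lift i)
  smooth_arr := s.smooth_preimage_conj_arrow K

theorem arrow_mem_pullbackArr (i : ι) (x : H.Obj) :
    (x, s.arrow i (F.obj x), s.lift i (F.obj x)) ∈ G.pullbackArr F.obj :=
  ⟨(s.tgt_arrow _ _).symm, s.src_arrow _ _⟩

/-- The arrows `lift i (F x) → x` of `H` that correspond to the arrows `F (lift i (F x)) → F x` of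
local lifts. -/
def liftedSections : TargetSections H ι where
  arrow i x := K.preimage ⟨_, s.arrow_mem_pullbackArr i x⟩
  dom i := F.obj ⁻¹' s.dom i
  tgt_arrow _ _ := K.tgt_preimage _
  isOpen_dom i := (s.isOpen_dom i).preimage F.smooth_obj.continuous
  smooth_arrow i :=
    SmoothOnSubset.contMDiffOn ((s.isOpen_dom i).preimage F.smooth_obj.continuous) <|
      K.smooth_preimage.comp
        (g := fun x : (F.obj ⁻¹' s.dom i : Set H.Obj) => ⟨_, s.arrow_mem_pullbackArr i x⟩) <|
      (SmoothOnSubset.of_contMDiff contMDiff_id).prodMk <|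
      (SmoothOnSubset.contMDiffOn_comp (s.isOpen_dom i) (s.smooth_arrow i)
        (SmoothOnSubset.of_contMDiff F.smooth_obj) fun x => x.2).prodMk <|
      SmoothOnSubset.contMDiffOn_comp (s.isOpen_dom i) (s.smooth_lift i)
        (SmoothOnSubset.of_contMDiff F.smooth_obj) fun x => x.2

theorem arr_liftedSections_arrow (i : ι) (x : H.Obj) :
    F.arr ((s.liftedSections K).arrow i x) = s.arrow i (F.obj x) :=
  K.arr_preimage _

theorem src_liftedSections_arrow (i : ι) (x : H.Obj) :
    H.src ((s.liftedSections K).arrow i x) = s.lift i (F.obj x) :=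
  K.src_preimage _

variable {n : ℕ}

theorem mapNerve_mapString_functor (p : G.nerve n) (a : Fin (n + 1) → ι) :
    F.mapNerve ((s.functor K).mapString p a) = s.conjFunctor.mapString p a :=
  nerve_ext (fun j => (s.src_arrow (a j) (p.1.1 j)).symm) fun j => by
    rw [LabelledFunctor.mapString_arr]
    exact (congrArg F.arr ((s.functor K).mapString_arr p a j)).trans (K.arr_preimage _)

theorem preimage_conj_arrow (a b : ι) (h : H.Arr) :
    K.preimage ⟨_, s.conj_arrow_mem_pullbackArr a b (F.arr h)⟩ =
      H.conj ((s.liftedSections K).arrow b (H.tgt h)) h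
        ((s.liftedSections K).arrow a (H.src h)) := by
  let T := s.liftedSections K
  refine K.arr_ext ?_ ?_ ?_
  · rw [T.tgt_conj_arrow, s.src_liftedSections_arrow, ← F.tgt_arr]
    exact K.tgt_preimage _
  · rw [F.map_conj (T.tgt_arrow _ _).symm (T.tgt_arrow _ _), s.arr_liftedSections_arrow,
      s.arr_liftedSections_arrow, ← F.tgt_arr, ← F.src_arr]
    exact K.arr_preimage _
  · rw [T.src_conj_arrow, s.src_liftedSections_arrow, ← F.src_arr]
    exact K.src_preimage _

theorem mapString_functor_mapNerve (p : H.nerve n) (a : Fin (n + 1) → ι) :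
    (s.functor K).mapString (F.mapNerve p) a = (s.liftedSections K).conjFunctor.mapString p a :=
  nerve_ext (fun _ => (s.src_liftedSections_arrow K _ _).symm) fun j => by
    rw [LabelledFunctor.mapString_arr, LabelledFunctor.mapString_arr]
    exact s.preimage_conj_arrow K _ _ _

end LocalLifts

end LieGroupoid

/-! ### Homotopy invariance -/

namespace LieGroupoid

variable {G H : LieGroupoid.{u}} {ι : Type*}

theorem Hom.vertexWeights_mapNerve (F : Hom H G)
    (ρ : SmoothPartitionOfUnity ι (𝓡 G.dimObj) G.Obj univ) {n : ℕ} (p : H.nerve n) :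
    vertexWeights ρ (F.mapNerve p) = vertexWeights (pullbackPartition ρ F.smooth_obj) p :=
  funext fun _ => Finsupp.ext fun _ => rfl

namespace LocalLifts

variable {F : Hom H G} (s : LocalLifts F ι) (K : F.FullyFaithful)
  {ρ : SmoothPartitionOfUnity ι (𝓡 G.dimObj) G.Obj univ} (hρ : ρ.IsSubordinate s.dom)

theorem pullbackMap_comp_averageMap :
    F.pullbackMap ≫ (s.functor K).averageMap ρ id hρ = s.conjFunctor.averageMap ρ id hρ :=
  cochainMap_comp_cochainMap _ _ _ fun _ c => Subtype.ext <| funext fun p =>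
    congrArg (labelAverage (vertexWeights ρ p)) <| funext fun a =>
      congrArg c.1 (s.mapNerve_mapString_functor K p a)

theorem averageMap_comp_pullbackMap :
    (s.functor K).averageMap ρ id hρ ≫ F.pullbackMap =
      (s.liftedSections K).conjFunctor.averageMap (pullbackPartition ρ F.smooth_obj) id
        (isSubordinate_pullbackPartition hρ F.smooth_obj) :=
  cochainMap_comp_cochainMap _ _ _ fun _ c => Subtype.ext <| funext fun p =>
    congrArg₂ (labelAverage · ·) (F.vertexWeights_mapNerve ρ p) <| funext fun a =>
      congrArg c.1 (s.mapString_functor_mapNerve K p a)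

/-- The homotopy equivalence between the cochain complexes given by pullback along a fully faithful
homomorphism and averaged pullback along its local quasi-inverses. -/
noncomputable def homotopyEquiv : HomotopyEquiv G.cochainComplex H.cochainComplex where
  hom := F.pullbackMap
  inv := (s.functor K).averageMap ρ id hρ
  homotopyHomInvId := (Homotopy.ofEq (s.pullbackMap_comp_averageMap K hρ)).trans
    (s.averageConjHomotopy hρ)
  homotopyInvHomId := (Homotopy.ofEq (s.averageMap_comp_pullbackMap K hρ)).trans
    ((s.liftedSections K).averageConjHomotopy _)

end LocalLifts

theorem Hom.IsWeakEquivalence.nonempty_homotopyEquiv {F : Hom H G} (h : F.IsWeakEquivalence) :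
    Nonempty (HomotopyEquiv G.cochainComplex H.cochainComplex) := by
  obtain ⟨hess, K, hleft, hright, hK⟩ := h
  obtain ⟨s, hs⟩ := hess.exists_localLifts
  have : LocallyCompactSpace G.Obj :=
    ChartedSpace.locallyCompactSpace (EuclideanSpace ℝ (Fin G.dimObj)) G.Obj
  obtain ⟨ρ, hρ⟩ := SmoothPartitionOfUnity.exists_isSubordinate (𝓡 G.dimObj) isClosed_univ s.dom
    s.isOpen_dom fun y _ => mem_iUnion.2 ⟨y, hs y⟩
  exact ⟨s.homotopyEquiv ⟨K, hleft, hright, hK⟩ hρ⟩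

theorem MoritaEquivalent.nonempty_homotopyEquiv (h : MoritaEquivalent G H) :
    Nonempty (HomotopyEquiv G.cochainComplex H.cochainComplex) := by
  induction h with
  | rel A B hAB =>
    obtain ⟨F, hF⟩ := hAB
    exact hF.nonempty_homotopyEquiv.map HomotopyEquiv.symm
  | refl A => exact ⟨HomotopyEquiv.refl _⟩
  | symm A B _ ih => exact ih.map HomotopyEquiv.symm
  | trans A B C _ _ ih₁ ih₂ => exact ih₁.map2 HomotopyEquiv.trans ih₂

end LieGroupoid

theorem mainTheorem9 (G H : LieGroupoid.{u}) (h : LieGroupoid.MoritaEquivalent G H) :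
    Nonempty (∀ n : ℕ, G.cohomology n ≃ₗ[ℝ] H.cohomology n) :=
  h.nonempty_homotopyEquiv.map fun e n => (e.toHomologyIso n).toLinearEquiv
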